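/- Let $p$ be a prime and let $(R,\mathfrak m,k)$ be a Noetherian local ring of characteristic $p$ and Krull dimension $d$ which is $F$-finite: $F_*R$ is a finitely generated $R$-module, where $F^e_*R$ denotes the abelian group $R$ with $r\in R$ acting as multiplication by $r^{p^e}$. Put $\alpha(R)=\log_p[k:k^p]$. A Cartier subalgebra on $R$ is a graded $\mathbb F_p$-subalgebra $\mathscr D=\bigoplus_{e\ge 0}\mathscr D_e$ of $\bigoplus_{e\ge 0}\operatorname{Hom}_R(F^e_*R,R)$ (multiplication being composition of additive maps $R\to R$) with $\mathscr D_0=\operatorname{Hom}_R(R,R)$ and $\mathscr D_e\ne 0$ for some $e>0$. In a direct sum decomposition $F^e_*R=\bigoplus_i M_i$ of $R$-modules, $M_j$ is called a $\mathscr D$-summand if $M_j\cong R$ and the projection $F^e_*R\to M_j\cong R$ belongs to $\mathscr D_e$. Let $a_e^{\mathscr D}$ be the maximal number of $\mathscr D$-summands in a direct sum decomposition of $F^e_*R$, let $\Gamma_{\mathscr D}=\{e\ge 0 : a_e^{\mathscr D}\neq 0\}$ and $n_{\mathscr D}=\gcd(\Gamma_{\mathscr D})$. **Theorem.** Let $\mathscr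 D$ be a Cartier subalgebra on such a ring $R$. If $n_{\mathscr D}\neq 0$, i.e. $\Gamma_{\mathscr D}\neq\{0\}$, then $\Gamma_{\mathscr D}$ is infinite, both of the limits $$s(R,\mathscr D)=\lim_{e\in\Gamma_{\mathscr D},\ e\to\infty}\frac{a_e^{\mathscr D}}{p^{e(d+\alpha(R))}}=\lim_{m\to\infty}\frac{a_{mn_{\mathscr D}}^{\mathscr D}}{p^{mn_{\mathscr D}(d+\alpha(R))}}$$ exist in $\mathbb R$, and they are equal; their common value is called the $F$-signature $s(R,\mathscr D)$ of $(R,\mathscr D)$. If $n_{\mathscr D}=0$, then $a_e^{\mathscr D}=0$ for all $e>0$, and $s(R,\mathscr D)=0$ by convention. -/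

import Mathlib

open Filter Topology

universe u

/-- The Frobenius push-forward `F^e_* R`: a copy of the abelian group `R`, on which `r : R` acts as
multiplication by `r ^ (p ^ e)` (see the `Module` instance below). -/
def FrobeniusPushforward (_p _e : ℕ) (R : Type u) : Type u := R

namespace FrobeniusPushforward

variable {p e : ℕ} {R : Type u} [CommRing R]

instance : AddCommGroup (FrobeniusPushforward p e R) := inferInstanceAs (AddCommGroup R)

/-- The identification of abelian groups `R ≃ F^e_* R`, usually written `x ↦ F^e_* x`. -/
def of (p e : ℕ) {R : Type u} [CommRing R] : R ≃+ FrobeniusPushforward p e R := AddEquiv.refl R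

/-- Restriction of scalars along the `e`-th iterate of the Frobenius endomorphism. -/
instance [ExpChar R p] : Module R (FrobeniusPushforward p e R) :=
  Module.compHom R (iterateFrobenius R p e)

theorem smul_of [ExpChar R p] (r x : R) : r • of p e x = of p e (r ^ p ^ e * x) := rfl

end FrobeniusPushforward

/-- The group `Hom_R(F^e_* R, R)` of `p^{-e}`-linear maps on `R`. -/
abbrev CartierMap (p e : ℕ) (R : Type u) [CommRing R] [ExpChar R p] : Type u :=
  FrobeniusPushforward p e R →ₗ[R] R

/-- The product of the total Cartier algebra: the composition of `φ` and `ψ`, viewed as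
additive maps on `R`. -/
def CartierMap.mul {p e₁ e₂ : ℕ} {R : Type u} [CommRing R] [ExpChar R p]
    (φ : CartierMap p e₁ R) (ψ : CartierMap p e₂ R) : CartierMap p (e₁ + e₂) R where
  toFun x := φ (.of p e₁ (ψ (.of p e₂ ((FrobeniusPushforward.of p (e₁ + e₂)).symm x))))
  map_add' x y := by simp
  map_smul' r x := by
    obtain ⟨x, rfl⟩ := (FrobeniusPushforward.of p (e₁ + e₂)).surjective x
    rw [FrobeniusPushforward.smul_of, AddEquiv.symm_apply_apply, AddEquiv.symm_apply_apply,
      pow_add, pow_mul, ← FrobeniusPushforward.smul_of, map_smul, smul_eq_mul,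
      ← FrobeniusPushforward.smul_of, map_smul, RingHom.id_apply]

/-- A Cartier subalgebra on `R`: a graded `𝔽_p`-subalgebra `D = ⨁ D_e` of the total Cartier algebra
`⨁ Hom_R(F^e_* R, R)` with `D_0 = Hom_R(R, R)` and `D_e ≠ 0` for some `e > 0`, given by its
homogeneous components. (The unit lies in `D_0`, and `𝔽_p`-linear combinations are sums.) -/
structure CartierSubalgebra (p : ℕ) (R : Type u) [CommRing R] [ExpChar R p] where
  /-- The homogeneous component of degree `e`. -/
  component : ∀ e : ℕ, AddSubgroup (CartierMap p e R)
  component_zero : component 0 = ⊤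
  mul_mem : ∀ {e₁ e₂ : ℕ} {φ : CartierMap p e₁ R} {ψ : CartierMap p e₂ R},
    φ ∈ component e₁ → ψ ∈ component e₂ → φ.mul ψ ∈ component (e₁ + e₂)
  exists_ne_bot : ∃ e : ℕ, 0 < e ∧ component e ≠ ⊥

/-- `R` is `F`-finite if `F_* R` is a finitely generated `R`-module. -/
def IsFFinite (p : ℕ) (R : Type u) [CommRing R] [ExpChar R p] : Prop :=
  Module.Finite R (FrobeniusPushforward p 1 R)

instance residueField_charP (p : ℕ) [Fact p.Prime] (R : Type u) [CommRing R] [IsLocalRing R]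
    [CharP R p] : CharP (IsLocalRing.ResidueField R) p :=
  (CharP.charP_iff_prime_eq_zero Fact.out).mpr <| by
    rw [← map_natCast (IsLocalRing.residue R), CharP.cast_eq_zero, map_zero]

/-- `α(R) = log_p [k : k^p]`, where `k` is the residue field of the local ring `R`. -/
noncomputable def frobeniusAlpha (p : ℕ) [Fact p.Prime] (R : Type u) [CommRing R] [IsLocalRing R]
    [CharP R p] : ℝ :=
  Real.logb p (Module.finrank (frobenius (IsLocalRing.ResidueField R) p).fieldRange
    (IsLocalRing.ResidueField R))

/-- The projection of `M` onto the `j`-th summand of an internal direct sum decomposition. -/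
noncomputable def internalProj {R M ι : Type*} [Ring R] [AddCommGroup M] [Module R M]
    [DecidableEq ι] {N : ι → Submodule R M} (h : DirectSum.IsInternal N) (j : ι) : M →ₗ[R] N j :=
  DirectSum.component R ι (fun i => N i) j ∘ₗ
    (LinearEquiv.ofBijective (DirectSum.coeLinearMap N) h).symm.toLinearMap

namespace CartierSubalgebra

section Splitting

variable {p : ℕ} {R : Type u} [CommRing R] [ExpChar R p] (D : CartierSubalgebra p R)

/-- In the direct sum decomposition `F^e_* R = ⨁ N i`, the summand `N j` is a `D`-summand if it is
isomorphic to `R` and the projection `F^e_* R → N j ≃ R` belongs to `D_e`. -/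
def IsSummand {e n : ℕ} {N : Fin n → Submodule R (FrobeniusPushforward p e R)}
    (h : DirectSum.IsInternal N) (j : Fin n) : Prop :=
  ∃ f : N j ≃ₗ[R] R, f.toLinearMap ∘ₗ internalProj h j ∈ D.component e

/-- The `e`-th `F`-splitting number `a_e` of `(R, D)`: the maximal number of `D`-summands in a
direct sum decomposition of `F^e_* R` as an `R`-module. -/
noncomputable def splittingNumber (e : ℕ) : ℕ :=
  sSup {a : ℕ | ∃ (n : ℕ) (N : Fin n → Submodule R (FrobeniusPushforward p e R))
    (h : DirectSum.IsInternal N), a = {j : Fin n | D.IsSummand h j}.ncard}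

/-- The semigroup `Γ_D` of those `e ≥ 0` with `a_e ≠ 0`. -/
def semigroup : Set ℕ := {e | D.splittingNumber e ≠ 0}

/-- The semigroup index `n_D = gcd Γ_D`. -/
noncomputable def semigroupIndex : ℕ := Nat.setGcd D.semigroup

end Splitting

variable {p : ℕ} [Fact p.Prime] {R : Type u} [CommRing R] [IsLocalRing R] [CharP R p]
  (D : CartierSubalgebra p R)

/-- The quotient `a_e / p ^ (e (d + α(R)))`. -/
noncomputable def normalizedSplittingNumber (d e : ℕ) : ℝ :=
  D.splittingNumber e / (p : ℝ) ^ ((e : ℝ) * (d + frobeniusAlpha p R))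

open Classical in
/-- The `F`-signature `s(R, D)` of `(R, D)`, where `d = dim R`: the limit of
`a_e / p ^ (e (d + α(R)))` over `e ∈ Γ_D`. If `n_D = 0`, that is, if `Γ_D` has no positive element,
there is no such limit to take, and `s(R, D) = 0` by convention. -/
noncomputable def fSignature (d : ℕ) : ℝ :=
  if D.semigroupIndex = 0 then 0
  else limUnder (atTop ⊓ 𝓟 D.semigroup) (D.normalizedSplittingNumber d)

end CartierSubalgebra

/-! Let `I_e` be the ideal of those `r` with `φ (F^e_* r) ∈ m` for all `φ ∈ D_e`. Splitting off free
summands one at a time gives `a_e = length F^e_*(R / I_e)`, so the theorem becomes a statement about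
lengths.

Write `δ = p^d [k : k^p]`, so that `p^(e(d + α)) = δ^e`. Since `I_e` contains `x^(p^e)` for every `x
∈ m`, a system of parameters gives `a_e = O(δ^e)`. If a fixed nonzerodivisor `z` is added to `I_e`,
the dimension drops and the length is `O(δ^e / p^e)`.

A positive element of `Γ` forces `R` to be reduced. If `R` is not a domain, the ideals `I_e` share a
nonzerodivisor and the limit is `0`. If `R` is a domain, let `r` be the rank of `F_* R`. A free
summand of `F^e_* R` has rank at most `r^e`, so the limit is `0` when `r < δ`. When `r ≥ δ`, a
nonzero map in `D_t`, for `t ∈ Γ`, yields `F^t_* R → R^(r^t)` with components in `D_t` and cokernel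
killed by some `z ≠ 0`. Applying `F^e_*` and using that `D_t` carries `I_(e+t)` into `I_e` bounds
`r^t a_e - a_(e+t)` by `O(δ^e / p^e)`. Thus the normalized numbers satisfy `s_e ≤ s_(e+t) + C_t /
p^e`: they are bounded and almost increasing, hence converge along multiples of `n_D`. Since `Γ` is
a semigroup, it contains all large multiples of its gcd and nothing outside them, so both limits
agree.

The carrying lemmas are `splittingNumber_spec`,
`Ideal.exists_frobeniusColength_le_of_mem_nonZeroDivisors`,
`mul_frobeniusColength_splittingIdeal_le` and `exists_tendsto_mul_of_le_add`. -/

/-! ### Colengths of ideals generated by powers, and parameters. -/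

theorem Module.length_le_add_of_exact {R M N P : Type*} [Ring R] [AddCommGroup M] [AddCommGroup N]
    [AddCommGroup P] [Module R M] [Module R N] [Module R P] (f : N →ₗ[R] M) (g : M →ₗ[R] P)
    (hg : Function.Surjective g) (H : Function.Exact f g) :
    Module.length R M ≤ Module.length R N + Module.length R P := by
  rw [Module.length_eq_add_of_exact (LinearMap.ker g).subtype g (Submodule.subtype_injective _) hg
    (LinearMap.exact_subtype_ker_map g), LinearMap.exact_iff.mp H]
  gcongr
  exact Module.length_le_of_surjective f.rangeRestrict f.surjective_rangeRestrict

section Colength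

variable {R : Type*} [CommRing R]

/-- Induction along the exact sequence `R/(J + x) → R/(J + x^(n+1)) → R/(J + x^n) → 0`, whose first
map is multiplication by `x^n`. -/
theorem Ideal.length_quotient_sup_span_pow_le (J : Ideal R) (x : R) (n : ℕ) :
    Module.length R (R ⧸ (J ⊔ Ideal.span {x ^ n})) ≤
      n * Module.length R (R ⧸ (J ⊔ Ideal.span {x})) := by
  induction n with
  | zero =>
    have : Subsingleton (R ⧸ (J ⊔ Ideal.span {x ^ 0})) :=
      Ideal.Quotient.subsingleton_iff.mpr (by simp [Ideal.span_singleton_one])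
    simp [Module.length_eq_zero]
  | succ n ih =>
    have h₁ : J ⊔ Ideal.span {x} ≤
        Submodule.comap (LinearMap.mulLeft R (x ^ n)) (J ⊔ Ideal.span {x ^ (n + 1)}) := by
      refine sup_le (fun y hy => Ideal.mem_sup_left (J.mul_mem_left _ hy)) ?_
      rw [Ideal.span_singleton_le_iff_mem]
      refine Ideal.mem_sup_right ?_
      rw [LinearMap.mulLeft_apply, ← pow_succ]
      exact Ideal.mem_span_singleton_self _
    have h₂ : J ⊔ Ideal.span {x ^ (n + 1)} ≤ J ⊔ Ideal.span {x ^ n} :=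
      sup_le_sup_left (Ideal.span_singleton_le_span_singleton.mpr (pow_dvd_pow x n.le_succ)) _
    have H : Function.Exact (Submodule.mapQ _ _ _ h₁) (Submodule.factor h₂) := by
      intro y
      obtain ⟨y, rfl⟩ := Submodule.Quotient.mk_surjective _ y
      rw [show Submodule.factor h₂ (Submodule.Quotient.mk y) = Submodule.Quotient.mk y from rfl,
        Submodule.Quotient.mk_eq_zero]
      constructor
      · intro hy
        obtain ⟨j, hj, z, hz, rfl⟩ := Submodule.mem_sup.mp hy
        obtain ⟨a, rfl⟩ := Ideal.mem_span_singleton'.mp hz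
        refine ⟨Submodule.Quotient.mk a, ?_⟩
        rw [Submodule.mapQ_apply, LinearMap.mulLeft_apply, Submodule.Quotient.eq]
        refine Ideal.mem_sup_left ?_
        convert J.neg_mem hj using 1
        ring
      · rintro ⟨a, ha⟩
        obtain ⟨a, rfl⟩ := Submodule.Quotient.mk_surjective _ a
        rw [Submodule.mapQ_apply, LinearMap.mulLeft_apply, Submodule.Quotient.eq] at ha
        have := sub_mem (Ideal.mem_sup_right (Ideal.mul_mem_right a _
          (Ideal.mem_span_singleton_self (x ^ n)))) (h₂ ha)
        simpa using this
    refine (Module.length_le_add_of_exact _ _ (Submodule.factor_surjective h₂) H).trans ?_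
    push_cast
    rw [add_mul, one_mul, add_comm]
    gcongr

theorem Ideal.length_quotient_sup_span_image_pow_le (s : Finset R) (J : Ideal R) (n : ℕ) :
    Module.length R (R ⧸ (J ⊔ Ideal.span ((· ^ n) '' (s : Set R)))) ≤
      n ^ s.card * Module.length R (R ⧸ (J ⊔ Ideal.span (s : Set R))) := by
  classical
  induction s using Finset.induction_on generalizing J with
  | empty =>
    rw [Finset.coe_empty, Set.image_empty, Finset.card_empty, pow_zero, one_mul]
  | insert a s ha ih =>
    rw [Finset.coe_insert, Set.image_insert_eq, Ideal.span_insert, Ideal.span_insert, ← sup_assoc,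
      ← sup_assoc, Finset.card_insert_of_notMem ha, pow_succ]
    refine (ih _).trans ?_
    rw [mul_assoc, sup_right_comm J (Ideal.span {a ^ n}), sup_right_comm J (Ideal.span {a})]
    exact mul_le_mul_right (Ideal.length_quotient_sup_span_pow_le _ _ _) _

open IsLocalRing in
-- Lift a system of parameters of `R / I`.
theorem IsLocalRing.exists_finset_length_quotient_ne_top [IsLocalRing R] [IsNoetherianRing R]
    (I : Ideal R) (hI : I ≠ ⊤) (t : ℕ) (ht : ringKrullDim (R ⧸ I) ≤ t) :
    ∃ s : Finset R, s.card ≤ t ∧ (s : Set R) ⊆ maximalIdeal R ∧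
      Module.length R (R ⧸ (I ⊔ Ideal.span (s : Set R))) ≠ ⊤ := by
  classical
  have : Nontrivial (R ⧸ I) := Ideal.Quotient.nontrivial_iff.mpr hI
  have := IsLocalRing.of_surjective' (Ideal.Quotient.mk I) Ideal.Quotient.mk_surjective
  have := IsLocalHom.of_surjective (Ideal.Quotient.mk I) Ideal.Quotient.mk_surjective
  obtain ⟨s, hs, hcard⟩ :=
    Ideal.exists_finset_card_eq_height_of_isNoetherianRing (maximalIdeal (R ⧸ I))
  have hart := IsLocalRing.quotient_artinian_of_mem_minimalPrimes_of_isLocalRing _ hs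
  obtain ⟨g, hg⟩ := (Ideal.Quotient.mk_surjective (I := I)).hasRightInverse
  have himg : Ideal.Quotient.mk I '' ((s.image g : Finset R) : Set R) = s := by
    rw [Finset.coe_image, Set.image_image]
    simp [hg _]
  refine ⟨s.image g, ?_, ?_, ?_⟩
  · have h1 : ((maximalIdeal (R ⧸ I)).height : WithBot ℕ∞) ≤ t :=
      (IsLocalRing.maximalIdeal_height_eq_ringKrullDim (R := R ⧸ I)).trans_le ht
    rw [← hcard] at h1
    exact Finset.card_image_le.trans (by exact_mod_cast h1)
  · intro x hx
    have : Ideal.Quotient.mk I x ∈ maximalIdeal (R ⧸ I) :=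
      hs.1.2 (Ideal.subset_span (himg ▸ Set.mem_image_of_mem _ hx))
    simpa using this
  · have e := (DoubleQuot.quotQuotEquivQuotSup I (Ideal.span ((s.image g : Finset R) : Set R)))
    rw [Ideal.map_span, himg] at e
    have : IsArtinianRing (R ⧸ (I ⊔ Ideal.span ((s.image g : Finset R) : Set R))) :=
      e.surjective.isArtinianRing
    rw [Module.length_eq_of_surjective
      (R := R ⧸ (I ⊔ Ideal.span ((s.image g : Finset R) : Set R))) Ideal.Quotient.mk_surjective]
    exact Module.length_ne_top

/-- Prime avoidance: an ideal of zero divisors lies in one associated prime `Ann z`, and then `z ≠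
0` kills the ideal. -/
theorem Ideal.exists_mem_nonZeroDivisors [IsNoetherianRing R] (I : Ideal R)
    (hI : ∀ z : R, (∀ x ∈ I, z * x = 0) → z = 0) : ∃ c ∈ I, c ∈ nonZeroDivisors R := by
  by_contra! h
  obtain ⟨P, hP, hIP⟩ := (I.subset_union_prime_finite (associatedPrimes.finite R R) (f := id) 0 0
    fun _ h _ _ ↦ h.isPrime).1 <| by
      simp_rw [id, biUnion_associatedPrimes_eq_compl_nonZeroDivisors]
      exact fun x hx => h x hx
  obtain ⟨hP', z, rfl⟩ := isAssociatedPrime_iff.mp hP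
  obtain rfl : z = 0 := hI z fun x hx => by simpa [mul_comm] using hIP hx
  exact hP'.ne_top (by simp)

end Colength

/-! ### Lengths and ranks under restriction of scalars along Frobenius. -/

/-- Any two simple modules over a local ring are isomorphic. -/
theorem IsLocalRing.nonempty_linearEquiv_of_isSimpleModule {B M N : Type*} [CommRing B]
    [IsLocalRing B] [AddCommGroup M] [Module B M] [AddCommGroup N] [Module B N]
    [hM : IsSimpleModule B M] [hN : IsSimpleModule B N] : Nonempty (M ≃ₗ[B] N) := by
  obtain ⟨I, hI, ⟨e⟩⟩ := isSimpleModule_iff_quot_maximal.mp hM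
  obtain ⟨J, hJ, ⟨e'⟩⟩ := isSimpleModule_iff_quot_maximal.mp hN
  obtain rfl := IsLocalRing.eq_maximalIdeal hI
  obtain rfl := IsLocalRing.eq_maximalIdeal hJ
  exact ⟨e.trans e'.symm⟩

/-- Restricting scalars along a homomorphism to a local ring multiplies lengths at most by
the length of a simple module. -/
theorem IsFiniteLength.length_restrictScalars_le {A B : Type*} [CommRing A] [CommRing B]
    [IsLocalRing B] [Algebra A B] {M : Type*} (S : Type*) [AddCommGroup M] [Module B M]
    [AddCommGroup S] [Module B S] [IsSimpleModule B S] [Module A S] [IsScalarTower A B S]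
    (h : IsFiniteLength B M) [Module A M] [IsScalarTower A B M] :
    Module.length A M ≤ Module.length B M * Module.length A S := by
  rename_i inst₁ inst₂
  revert inst₁ inst₂
  induction h with
  | of_subsingleton => intros; simp [Module.length_eq_zero]
  | @of_simple_quotient M _ _ N _ _ ih =>
    intros
    rw [Module.length_eq_add_of_exact N.subtype N.mkQ (Submodule.subtype_injective _)
      N.mkQ_surjective (LinearMap.exact_subtype_mkQ N), Module.length_eq_one B (M ⧸ N), add_mul,
      one_mul]
    refine (Module.length_le_add_of_exact (N.subtype.restrictScalars A) (N.mkQ.restrictScalars A)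
      N.mkQ_surjective (LinearMap.exact_subtype_mkQ N)).trans ?_
    gcongr
    · exact ih
    · obtain ⟨e⟩ := IsLocalRing.nonempty_linearEquiv_of_isSimpleModule (B := B) (M := M ⧸ N) (N := S)
      exact (e.restrictScalars A).length_eq.le

theorem IsFiniteLength.length_compHom_le {A B : Type*} [CommRing A] [CommRing B]
    [IsLocalRing B] (f : A →+* B) {M : Type*} (S : Type*) [AddCommGroup M] [Module B M]
    [AddCommGroup S] [Module B S] [IsSimpleModule B S] (h : IsFiniteLength B M) :
    @Module.length A M _ _ (Module.compHom M f) ≤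
      Module.length B M * @Module.length A S _ _ (Module.compHom S f) := by
  let := f.toAlgebra
  let := Module.compHom M f
  let := Module.compHom S f
  have : IsScalarTower A B M := ⟨fun a b x => mul_smul (f a) b x⟩
  have : IsScalarTower A B S := ⟨fun a b x => mul_smul (f a) b x⟩
  exact h.length_restrictScalars_le S

/-- The Frobenius twist `F^e_* M` of a module `M`: a copy of `M` on which `r` acts as
multiplication by `r ^ (p ^ e)`. -/
def FrobeniusTwist (_p _e : ℕ) (M : Type*) : Type _ := M

namespace FrobeniusTwist

variable (p e : ℕ) {R M : Type*} [CommRing R] [ExpChar R p] [AddCommGroup M] [Module R M]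

instance : AddCommGroup (FrobeniusTwist p e M) := inferInstanceAs (AddCommGroup M)

instance : Module R (FrobeniusTwist p e M) :=
  Module.compHom M (iterateFrobenius R p e)

end FrobeniusTwist

/-- The rank of the target of a ring homomorphism as a module over the source. -/
noncomputable def RingHom.degree {A B : Type*} [CommRing A] [CommRing B] (f : A →+* B) : ℕ :=
  @Module.finrank A B _ _ f.toAlgebra.toModule

theorem RingHom.degree_comp {A B C : Type*} [CommRing A] [CommRing B] [CommRing C] [IsDomain C]
    (f : A →+* B) (g : B →+* C) (hg : Function.Injective g) :
    (g.comp f).degree = f.degree * g.degree := by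
  algebraize [f, g, g.comp f]
  have : FaithfulSMul B C := (faithfulSMul_iff_algebraMap_injective B C).mpr hg
  exact (Module.finrank_mul_finrank' C).symm

theorem RingHom.degree_iterateFrobenius (p e : ℕ) (A : Type*) [CommRing A] [IsDomain A]
    [ExpChar A p] : (iterateFrobenius A p e).degree = (frobenius A p).degree ^ e := by
  induction e with
  | zero =>
    rw [pow_zero, iterateFrobenius_zero]
    exact Module.finrank_self A
  | succ e ih =>
    rw [pow_succ, ← ih, ← RingHom.degree_comp _ _ (frobenius_inj A p)]
    congr 1
    ext x
    simp [iterateFrobenius_def, frobenius_def, pow_succ, pow_mul]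

theorem RingHom.finrank_fieldRange {K L : Type*} [Field K] [Field L] (f : K →+* L) :
    Module.finrank f.fieldRange L = f.degree := by
  algebraize [f]
  exact (Algebra.finrank_eq_of_equiv_equiv
    (RingEquiv.ofBijective f.rangeRestrictField f.rangeRestrictField_bijective)
    (RingEquiv.refl L) rfl).symm

theorem FrobeniusTwist.finrank_eq_degree (p e : ℕ) (A : Type*) [CommRing A] [IsDomain A] [ExpChar A p] :
    Module.finrank A (FrobeniusTwist p e A) = (frobenius A p).degree ^ e := by
  rw [← RingHom.degree_iterateFrobenius]
  rfl

theorem RingHom.Finite.iterateFrobenius {p : ℕ} {R : Type*} [CommRing R] [ExpChar R p]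
    (h : (frobenius R p).Finite) (e : ℕ) : (iterateFrobenius R p e).Finite := by
  induction e with
  | zero => rw [iterateFrobenius_zero]; exact RingHom.Finite.id R
  | succ e ih =>
    convert h.comp ih using 1
    ext x
    simp [iterateFrobenius_def, frobenius_def, pow_succ, pow_mul]

theorem RingHom.Finite.frobenius_of_surjective {p : ℕ} {R S : Type*} [CommRing R] [CommRing S]
    [ExpChar R p] [ExpChar S p] (h : (frobenius R p).Finite) (f : R →+* S)
    (hf : Function.Surjective f) : (frobenius S p).Finite := by
  refine RingHom.Finite.of_comp_finite (f := f) ?_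
  rw [show (frobenius S p).comp f = f.comp (frobenius R p) from RingHom.ext fun x => by
    simp [frobenius_def]]
  exact (RingHom.Finite.of_surjective f hf).comp h

theorem IsFFinite.frobenius_finite {p : ℕ} {R : Type*} [CommRing R] [ExpChar R p]
    (h : IsFFinite p R) : (frobenius R p).Finite := by
  rw [← iterateFrobenius_one]
  exact h

theorem RingHom.Finite.finite_frobeniusTwist {p : ℕ} {R : Type*} [CommRing R] [ExpChar R p]
    (h : (frobenius R p).Finite) (e : ℕ) : Module.Finite R (FrobeniusTwist p e R) :=
  h.iterateFrobenius e

theorem IsFFinite.finite_frobeniusPushforward {p : ℕ} {R : Type*} [CommRing R] [ExpChar R p]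
    (h : IsFFinite p R) (e : ℕ) : Module.Finite R (FrobeniusPushforward p e R) :=
  h.frobenius_finite.iterateFrobenius e

open IsLocalRing in
-- By dévissage it is enough to treat the simple module `k`, where `F^e_* k` has length `[k :
-- k^p]^e`.
theorem FrobeniusTwist.length_le {p : ℕ} [Fact p.Prime] {R : Type*} [CommRing R] [IsLocalRing R]
    [CharP R p] (hR : IsFFinite p R) (e : ℕ) {M : Type*} [AddCommGroup M] [Module R M]
    (hM : IsFiniteLength R M) :
    Module.length R (FrobeniusTwist p e M) ≤
      Module.length R M * ((frobenius (ResidueField R) p).degree ^ e : ℕ) := by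
  have key : Module.length R (FrobeniusTwist p e (ResidueField R)) =
      ((frobenius (ResidueField R) p).degree ^ e : ℕ) := by
    have : Module.Finite (ResidueField R) (FrobeniusTwist p e (ResidueField R)) :=
      (hR.frobenius_finite.frobenius_of_surjective _ (residue_surjective (R := R))).finite_frobeniusTwist e
    have : IsScalarTower R (ResidueField R) (FrobeniusTwist p e (ResidueField R)) :=
      ⟨fun a b x => by
        change (algebraMap R (ResidueField R) a * b) ^ p ^ e * _ =
          algebraMap R (ResidueField R) (a ^ p ^ e) * (b ^ p ^ e * _)
        rw [mul_pow, map_pow]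
        exact mul_assoc (_ : ResidueField R) _ _⟩
    rw [Module.length_eq_of_surjective (R := ResidueField R) (residue_surjective (R := R)),
      Module.length_eq_finrank, FrobeniusTwist.finrank_eq_degree]
  rw [← key]
  have : IsSimpleModule R (ResidueField R) :=
    isSimpleModule_iff_quot_maximal.mpr ⟨_, maximalIdeal.isMaximal R, ⟨LinearEquiv.refl _ _⟩⟩
  exact hM.length_compHom_le (iterateFrobenius R p e) (ResidueField R)

/-! ### Growth of the length of `F^e_*(R / J)`. -/

namespace Ideal

variable {R : Type*} [CommRing R]

/-- The submodule `F^e_* J` of `F^e_* R` given by an ideal `J`. -/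
def frobeniusPushforward (p e : ℕ) [ExpChar R p] (J : Ideal R) :
    Submodule R (FrobeniusPushforward p e R) where
  carrier := {x | (FrobeniusPushforward.of p e).symm x ∈ J}
  add_mem' hx hy := by
    rw [Set.mem_ofPred, map_add]
    exact J.add_mem hx hy
  zero_mem' := by
    rw [Set.mem_ofPred, map_zero]
    exact J.zero_mem
  smul_mem' r x hx := by
    obtain ⟨x, rfl⟩ := (FrobeniusPushforward.of p e).surjective x
    exact J.mul_mem_left _ hx

theorem mem_frobeniusPushforward {p e : ℕ} [ExpChar R p] {J : Ideal R}
    {x : FrobeniusPushforward p e R} :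
    x ∈ J.frobeniusPushforward p e ↔ (FrobeniusPushforward.of p e).symm x ∈ J := Iff.rfl

theorem frobeniusPushforward_mono (p e : ℕ) [ExpChar R p] {I J : Ideal R} (h : I ≤ J) :
    I.frobeniusPushforward p e ≤ J.frobeniusPushforward p e := fun _ hx => h hx

/-- The length of `F^e_* (R / J)` as an `R`-module. -/
noncomputable def frobeniusColength (p e : ℕ) [ExpChar R p] (J : Ideal R) : ℕ∞ :=
  Module.length R (FrobeniusPushforward p e R ⧸ J.frobeniusPushforward p e)

theorem frobeniusColength_anti (p e : ℕ) [ExpChar R p] {I J : Ideal R} (h : I ≤ J) :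
    J.frobeniusColength p e ≤ I.frobeniusColength p e :=
  Module.length_le_of_surjective (Submodule.factor (frobeniusPushforward_mono p e h))
    (Submodule.factor_surjective _)

theorem frobeniusColength_top (p e : ℕ) [ExpChar R p] :
    (⊤ : Ideal R).frobeniusColength p e = 0 := by
  have : Subsingleton (FrobeniusPushforward p e R ⧸ (⊤ : Ideal R).frobeniusPushforward p e) := by
    rw [Submodule.Quotient.subsingleton_iff, eq_top_iff]
    exact fun _ _ => Submodule.mem_top
  exact Module.length_eq_zero

open IsLocalRing

variable {p : ℕ} [Fact p.Prime] [IsLocalRing R] [CharP R p]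

theorem frobeniusColength_le (hR : IsFFinite p R) (e : ℕ) {J : Ideal R}
    (hJ : Module.length R (R ⧸ J) ≠ ⊤) :
    J.frobeniusColength p e ≤
      Module.length R (R ⧸ J) * ((frobenius (IsLocalRing.ResidueField R) p).degree ^ e : ℕ) := by
  refine le_trans ?_ (FrobeniusTwist.length_le hR e (Module.length_ne_top_iff.mp hJ))
  let g : FrobeniusPushforward p e R →ₗ[R] FrobeniusTwist p e (R ⧸ J) :=
    { toFun := fun x => Ideal.Quotient.mk J ((FrobeniusPushforward.of p e).symm x)
      map_add' := fun x y => by rw [map_add, map_add]; rfl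
      map_smul' := fun r x => rfl }
  have hg : LinearMap.ker g = J.frobeniusPushforward p e := by
    ext x
    exact Ideal.Quotient.eq_zero_iff_mem
  exact Module.length_le_of_injective ((J.frobeniusPushforward p e).liftQ g hg.ge)
    (LinearMap.ker_eq_bot.mp (Submodule.ker_liftQ_eq_bot _ _ _ hg.le))

/-- If `dim R / I ≤ t`, then the length of `F^e_* (R / (I + m^[p^e]))` is
`O(p^(et) [k : k^p]^e)`. -/
theorem exists_frobeniusColength_le [IsNoetherianRing R] (hR : IsFFinite p R) (I : Ideal R)
    (hI : I ≠ ⊤) (t : ℕ) (ht : ringKrullDim (R ⧸ I) ≤ t) :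
    ∃ C : ℕ, ∀ (e : ℕ) (J : Ideal R), I ≤ J → (∀ x ∈ maximalIdeal R, x ^ p ^ e ∈ J) →
      J.frobeniusColength p e ≤
        (C * (p ^ t * (frobenius (IsLocalRing.ResidueField R) p).degree) ^ e : ℕ) := by
  obtain ⟨s, hs, hsm, hfin⟩ := IsLocalRing.exists_finset_length_quotient_ne_top I hI t ht
  obtain ⟨C, hC⟩ := ENat.ne_top_iff_exists.mp hfin
  refine ⟨C, fun e J hIJ hJ => ?_⟩
  -- At most `t` parameters modulo `I` suffice, and raising each to the power `p^e` multiplies the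
  -- colength by at most `p^(et)`.
  have hle : I ⊔ Ideal.span ((· ^ p ^ e) '' (s : Set R)) ≤ J := by
    refine sup_le hIJ (Ideal.span_le.mpr ?_)
    rintro _ ⟨x, hx, rfl⟩
    exact hJ x (hsm hx)
  have hlen : Module.length R (R ⧸ (I ⊔ Ideal.span ((· ^ p ^ e) '' (s : Set R)))) ≤
      ((p ^ e) ^ t * C : ℕ) := by
    refine (Ideal.length_quotient_sup_span_image_pow_le s I (p ^ e)).trans ?_
    rw [← hC]
    have : (p ^ e) ^ s.card * C ≤ (p ^ e) ^ t * C :=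
      Nat.mul_le_mul_right _ (Nat.pow_le_pow_right (pow_pos (Fact.out : p.Prime).pos _) hs)
    exact_mod_cast this
  refine (frobeniusColength_anti p e hle).trans
    ((frobeniusColength_le hR e (ne_top_of_le_ne_top (ENat.natCast_ne_top _) hlen)).trans ?_)
  refine (mul_le_mul_left hlen _).trans (le_of_eq ?_)
  rw [← Nat.cast_mul]
  congr 1
  rw [mul_pow, ← pow_mul, ← pow_mul, mul_comm e t]
  ring

/-- A nonzerodivisor lowers the dimension by at least one, which gains a factor `p^e`. It is kept on
the left so that the estimate stays among natural numbers. -/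
theorem exists_frobeniusColength_le_of_mem_nonZeroDivisors [IsNoetherianRing R]
    (hR : IsFFinite p R) {d : ℕ} (hd : ringKrullDim R = d) {z : R} (hz : z ∈ nonZeroDivisors R) :
    ∃ C : ℕ, ∀ (e : ℕ) (J : Ideal R), z ∈ J → (∀ x ∈ maximalIdeal R, x ^ p ^ e ∈ J) →
      (p ^ e : ℕ) * J.frobeniusColength p e ≤
        (C * (p ^ d * (frobenius (IsLocalRing.ResidueField R) p).degree) ^ e : ℕ) := by
  by_cases hI : Ideal.span {z} = ⊤
  · refine ⟨0, fun e J hzJ _ => ?_⟩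
    rw [← Ideal.span_singleton_le_iff_mem, hI, top_le_iff] at hzJ
    simp [hzJ, frobeniusColength_top]
  · have hdim := ringKrullDim_quotient_succ_le_of_nonZeroDivisor hz
    have : Nontrivial (R ⧸ Ideal.span {z}) := Ideal.Quotient.nontrivial_iff.mpr hI
    obtain ⟨t, rfl, ht⟩ : ∃ t, d = t + 1 ∧ ringKrullDim (R ⧸ Ideal.span {z}) ≤ t := by
      have h0 := ringKrullDim_nonneg_of_nontrivial (R := R ⧸ Ideal.span {z})
      rw [hd] at hdim
      obtain _ | t := d
      · have := (add_le_add_left h0 1).trans hdim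
        norm_num at this
      · refine ⟨t, rfl, ?_⟩
        rw [Nat.cast_add, Nat.cast_one] at hdim
        exact (ENat.WithBot.add_le_add_one_right_iff).mp hdim
    obtain ⟨C, hC⟩ := exists_frobeniusColength_le hR _ hI t ht
    refine ⟨C, fun e J hzJ hJ => ?_⟩
    refine (mul_le_mul_right (hC e J ((Ideal.span_singleton_le_iff_mem _).mpr hzJ) hJ) _).trans
      (le_of_eq ?_)
    rw [← Nat.cast_mul]
    congr 1
    rw [mul_pow, mul_pow, ← pow_mul, ← pow_mul, add_mul, pow_add]
    ring

end Ideal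

/-! ### Cartier maps, and `D`-summands as dual families. -/

namespace CartierSubalgebra

section Ring

variable {p : ℕ} {R : Type u} [CommRing R] [ExpChar R p] (D : CartierSubalgebra p R)

/-- The `p^0`-linear map given by multiplication by `s`. -/
def mulMap (p : ℕ) {R : Type u} [CommRing R] [ExpChar R p] (s : R) : CartierMap p 0 R where
  toFun x := s * (FrobeniusPushforward.of p 0).symm x
  map_add' x y := by rw [map_add, mul_add]
  map_smul' r x := by
    obtain ⟨x, rfl⟩ := (FrobeniusPushforward.of p 0).surjective x
    rw [FrobeniusPushforward.smul_of, AddEquiv.symm_apply_apply, AddEquiv.symm_apply_apply,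
      pow_zero, pow_one, RingHom.id_apply, smul_eq_mul, mul_left_comm]

theorem mem_component_of_forall_eq {e e' : ℕ} (h : e' = e) {ψ : CartierMap p e' R}
    (hψ : ψ ∈ D.component e') {φ : CartierMap p e R}
    (heq : ∀ x : R, φ (.of p e x) = ψ (.of p e' x)) : φ ∈ D.component e := by
  subst h
  convert hψ
  ext x
  exact heq x

theorem smul_mem_component {e : ℕ} {φ : CartierMap p e R} (hφ : φ ∈ D.component e) (r : R) :
    r • φ ∈ D.component e :=
  D.mem_component_of_forall_eq (zero_add e)
    (D.mul_mem (φ := mulMap p r) (by rw [D.component_zero]; trivial) hφ) fun _ => rfl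

/-- Precomposition of a `p^{-e}`-linear map with multiplication by `s`. -/
def precompMul {e : ℕ} (φ : CartierMap p e R) (s : R) : CartierMap p e R where
  toFun x := φ (.of p e (s * (FrobeniusPushforward.of p e).symm x))
  map_add' x y := by rw [map_add, mul_add, map_add, map_add]
  map_smul' r x := by
    obtain ⟨x, rfl⟩ := (FrobeniusPushforward.of p e).surjective x
    rw [FrobeniusPushforward.smul_of, AddEquiv.symm_apply_apply, AddEquiv.symm_apply_apply,
      mul_left_comm, ← FrobeniusPushforward.smul_of, map_smul, RingHom.id_apply]

theorem precompMul_mem_component {e : ℕ} {φ : CartierMap p e R} (hφ : φ ∈ D.component e) (s : R) :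
    precompMul φ s ∈ D.component e :=
  D.mem_component_of_forall_eq (add_zero e)
    (D.mul_mem hφ (ψ := mulMap p s) (by rw [D.component_zero]; trivial)) fun _ => rfl

theorem map_pow_mul {e : ℕ} (φ : CartierMap p e R) (r x : R) :
    φ (.of p e (r ^ p ^ e * x)) = r * φ (.of p e x) := by
  rw [← FrobeniusPushforward.smul_of, map_smul, smul_eq_mul]

/-- A family of `n` elements of `F^e_* R` with dual family in `D_e`. -/
def IsDualFamily {e : ℕ} {ι : Type*} [DecidableEq ι] (φ : ι → CartierMap p e R)
    (v : ι → FrobeniusPushforward p e R) : Prop :=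
  (∀ i, φ i ∈ D.component e) ∧ ∀ i j, φ i (v j) = if i = j then 1 else 0

theorem internalProj_coe {M ι : Type*} [AddCommGroup M] [Module R M]
    [DecidableEq ι] {N : ι → Submodule R M} (h : DirectSum.IsInternal N) (j : ι)
    (y : DirectSum ι fun i => N i) : internalProj h j (DirectSum.coeLinearMap N y) = y j := by
  have := (LinearEquiv.ofBijective (DirectSum.coeLinearMap N) h).symm_apply_apply y
  exact congrArg (fun z => z j) this

variable {D}

theorem exists_isDualFamily_of_isInternal {e n : ℕ}
    {N : Fin n → Submodule R (FrobeniusPushforward p e R)} (h : DirectSum.IsInternal N) :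
    ∃ (φ : {j // D.IsSummand h j} → CartierMap p e R)
      (v : {j // D.IsSummand h j} → FrobeniusPushforward p e R), D.IsDualFamily φ v := by
  choose f hf using fun j : {j // D.IsSummand h j} => j.2
  refine ⟨fun j => (f j).toLinearMap ∘ₗ internalProj h j, fun j => ((f j).symm 1 : N j), hf,
    fun i j => ?_⟩
  have := internalProj_coe h i (DirectSum.lof R _ (fun i => N i) j ((f j).symm 1))
  rw [DirectSum.coeLinearMap_lof] at this
  rw [LinearMap.comp_apply, this]
  split_ifs with hij
  · subst hij
    rw [DirectSum.lof_apply]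
    exact (f i).apply_symm_apply 1
  · rw [DirectSum.lof_eq_of, DirectSum.of_eq_of_ne _ _ _ (fun h => hij (Subtype.ext h)), map_zero]

theorem IsDualFamily.exists_isInternal {e n : ℕ} {φ : Fin n → CartierMap p e R}
    {v : Fin n → FrobeniusPushforward p e R} (hv : D.IsDualFamily φ v) :
    ∃ (N : Fin (n + 1) → Submodule R (FrobeniusPushforward p e R)) (h : DirectSum.IsInternal N),
      n ≤ {j | D.IsSummand h j}.ncard := by
  classical
  -- Index `0` holds the complement, the common kernel of the `φ i`; the other indices hold the free
  -- lines spanned by the `v i`.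
  let N : Fin (n + 1) → Submodule R (FrobeniusPushforward p e R) :=
    Fin.cons (⨅ i, LinearMap.ker (φ i)) fun i => Submodule.span R {v i}
  have hsum : ∀ y : DirectSum (Fin (n + 1)) fun i => N i,
      DirectSum.coeLinearMap N y = ∑ i, (y i : FrobeniusPushforward p e R) := by
    intro y
    rw [DirectSum.coeLinearMap_eq_dfinsuppSum, DFinsupp.sum_eq_sum_fintype _ (fun _ => rfl)]
    rfl
  have hφN : ∀ (i : Fin n) (y : DirectSum (Fin (n + 1)) fun i => N i),
      φ i (DirectSum.coeLinearMap N y) = φ i (y i.succ) := by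
    intro i y
    rw [hsum, map_sum, Finset.sum_eq_single i.succ]
    · intro j _ hj
      cases j using Fin.cases with
      | zero =>
        have := (y 0).2
        exact (Submodule.mem_iInf _).mp this i
      | succ j =>
        obtain ⟨r, hr⟩ := Submodule.mem_span_singleton.mp (y j.succ).2
        rw [← hr, map_smul, hv.2, if_neg (fun h => hj (by rw [h])), smul_zero]
    · simp
  have hinj : ∀ (i : Fin n) (w : N i.succ), φ i w = 0 → w = 0 := by
    intro i w hw
    obtain ⟨r, hr⟩ := Submodule.mem_span_singleton.mp w.2
    rw [← hr, map_smul, hv.2, if_pos rfl, smul_eq_mul, mul_one] at hw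
    ext
    rw [← hr, hw, zero_smul]
    rfl
  have h : DirectSum.IsInternal N := by
    constructor
    · rw [injective_iff_map_eq_zero]
      intro y hy
      have hsucc : ∀ i : Fin n, y i.succ = 0 := fun i =>
        hinj i _ (by rw [← hφN]; exact (congrArg (φ i) hy).trans (map_zero _))
      have hy' : DirectSum.coeLinearMap N y = 0 := hy
      rw [hsum, Fin.sum_univ_succ] at hy'
      simp only [hsucc, ZeroMemClass.coe_zero, Finset.sum_const_zero, add_zero] at hy'
      ext i : 1
      cases i using Fin.cases with
      | zero => exact Subtype.ext hy'
      | succ i => exact hsucc i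
    · intro x
      have h0 : x - ∑ i, φ i x • v i ∈ N 0 := by
        refine (Submodule.mem_iInf _).mpr fun i => ?_
        rw [LinearMap.mem_ker, map_sub, map_sum, Finset.sum_eq_single i]
        · rw [map_smul, hv.2, if_pos rfl, smul_eq_mul, mul_one, sub_self]
        · intro j _ hj
          rw [map_smul, hv.2, if_neg hj.symm, smul_zero]
        · simp
      refine ⟨DirectSum.lof R _ (fun i => N i) 0 ⟨_, h0⟩ + ∑ i : Fin n,
        DirectSum.lof R _ (fun i => N i) i.succ
          ⟨φ i x • v i, Submodule.smul_mem _ _ (Submodule.mem_span_singleton_self _)⟩, ?_⟩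
      change DirectSum.coeLinearMap N _ = _
      rw [map_add, map_sum]
      simp only [DirectSum.coeLinearMap_lof]
      exact sub_add_cancel _ _
  refine ⟨N, h, ?_⟩
  have hsub : Set.range (Fin.succ : Fin n → Fin (n + 1)) ⊆ {j | D.IsSummand h j} := by
    rintro _ ⟨i, rfl⟩
    refine ⟨LinearEquiv.ofBijective (φ i ∘ₗ (N i.succ).subtype) ⟨?_, fun r => ?_⟩, ?_⟩
    · rw [injective_iff_map_eq_zero]
      exact fun w hw => hinj i w hw
    · refine ⟨⟨r • v i, Submodule.smul_mem _ _ (Submodule.mem_span_singleton_self _)⟩, ?_⟩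
      change φ i (r • v i) = r
      rw [map_smul, hv.2, if_pos rfl, smul_eq_mul, mul_one]
    · convert hv.1 i
      ext x
      obtain ⟨y, rfl⟩ := h.2 x
      have := internalProj_coe h i.succ y
      change φ i (internalProj h i.succ (DirectSum.coeLinearMap N y)) = _
      rw [this, ← hφN]
      rfl
  calc n = (Set.range (Fin.succ : Fin n → Fin (n + 1))).ncard := by
        rw [← Set.image_univ, Set.ncard_image_of_injective _ (Fin.succ_injective n)]
        simp
    _ ≤ _ := Set.ncard_le_ncard hsub (Set.toFinite _)

end Ring

end CartierSubalgebra

open IsLocalRing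

/-! ### Splitting ideals and the formula `a_e = length F^e_*(R / I_e)`. -/

namespace CartierSubalgebra

section LocalRing

variable {p : ℕ} {R : Type u} [CommRing R] [IsLocalRing R] [ExpChar R p]
  (D : CartierSubalgebra p R)

/-- The splitting ideal `I_e` of those `r` with `φ (F^e_* r) ∈ m` for all `φ ∈ D_e`. -/
def splittingIdeal (e : ℕ) : Ideal R where
  carrier := {r | ∀ φ ∈ D.component e, φ (.of p e r) ∈ maximalIdeal R}
  add_mem' hx hy φ hφ := by
    rw [map_add, map_add]
    exact add_mem (hx φ hφ) (hy φ hφ)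
  zero_mem' φ _ := by
    rw [map_zero, map_zero]
    exact zero_mem _
  smul_mem' s _ hx φ hφ := hx (precompMul φ s) (D.precompMul_mem_component hφ s)

variable {D}

theorem mem_splittingIdeal {e : ℕ} {r : R} :
    r ∈ D.splittingIdeal e ↔ ∀ φ ∈ D.component e, φ (.of p e r) ∈ maximalIdeal R := Iff.rfl

theorem pow_mem_splittingIdeal (e : ℕ) {x : R} (hx : x ∈ maximalIdeal R) :
    x ^ p ^ e ∈ D.splittingIdeal e := fun φ _ => by
  rw [← mul_one (x ^ p ^ e), map_pow_mul]
  exact Ideal.mul_mem_right _ _ hx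

/-- Closure of `D` under composition enters here. This compatibility is what relates `a_e` to `a_(e
+ e')`. -/
theorem map_mem_splittingIdeal {e e' : ℕ} {φ : CartierMap p e' R} (hφ : φ ∈ D.component e') {r : R}
    (hr : r ∈ D.splittingIdeal (e + e')) : φ (.of p e' r) ∈ D.splittingIdeal e :=
  fun ψ hψ => hr (ψ.mul φ) (D.mul_mem hψ hφ)

theorem IsDualFamily.surjective {e : ℕ} {ι : Type*} [Fintype ι] [DecidableEq ι]
    {φ : ι → CartierMap p e R} {v : ι → FrobeniusPushforward p e R} (hv : D.IsDualFamily φ v) :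
    Function.Surjective
      (LinearMap.pi fun i => Algebra.linearMap R (ResidueField R) ∘ₗ φ i) := by
  intro c
  choose b hb using fun i => residue_surjective (R := R) (c i)
  refine ⟨∑ j, b j • v j, funext fun i => ?_⟩
  rw [LinearMap.pi_apply, LinearMap.comp_apply, map_sum, Finset.sum_eq_single i]
  · rw [map_smul, hv.2, if_pos rfl, smul_eq_mul, mul_one]
    exact hb i
  · intro j _ hj
    rw [map_smul, hv.2, if_neg hj.symm, smul_zero]
  · simp

theorem splittingIdeal_le_ker {e : ℕ} {ι : Type*} {φ : ι → CartierMap p e R}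
    (hφ : ∀ i, φ i ∈ D.component e) :
    (D.splittingIdeal e).frobeniusPushforward p e ≤
      LinearMap.ker (LinearMap.pi fun i => Algebra.linearMap R (ResidueField R) ∘ₗ φ i) := by
  intro x hx
  rw [LinearMap.mem_ker]
  exact funext fun i => (residue_eq_zero_iff _).mpr (hx (φ i) (hφ i))

theorem length_pi_residueField (ι : Type*) [Fintype ι] :
    Module.length R (ι → ResidueField R) = Fintype.card ι := by
  have : IsSimpleModule R (ResidueField R) :=
    isSimpleModule_iff_quot_maximal.mpr ⟨_, maximalIdeal.isMaximal R, ⟨LinearEquiv.refl _ _⟩⟩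
  simp [Module.length_pi_of_fintype]

theorem IsDualFamily.card_le {e : ℕ} {ι : Type*} [Fintype ι] [DecidableEq ι]
    {φ : ι → CartierMap p e R} {v : ι → FrobeniusPushforward p e R} (hv : D.IsDualFamily φ v) :
    (Fintype.card ι : ℕ∞) ≤ (D.splittingIdeal e).frobeniusColength p e := by
  rw [← length_pi_residueField (R := R)]
  refine Module.length_le_of_surjective (Submodule.liftQ _ _ (splittingIdeal_le_ker hv.1)) ?_
  rw [← LinearMap.range_eq_top, Submodule.range_liftQ, LinearMap.range_eq_top]
  exact hv.surjective

/-- If every `x` agrees modulo `I_e` with its expansion in the `v i`, then `F^e_*(R / I_e)` is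
`k^n`. Otherwise some remainder is sent to a unit by a map in `D_e`, and this splits off one more
free summand. -/
theorem IsDualFamily.frobeniusColength_eq_or_exists {e n : ℕ} {φ : Fin n → CartierMap p e R}
    {v : Fin n → FrobeniusPushforward p e R} (hv : D.IsDualFamily φ v) :
    (D.splittingIdeal e).frobeniusColength p e = n ∨
      ∃ (φ' : Fin (n + 1) → CartierMap p e R) (v' : Fin (n + 1) → FrobeniusPushforward p e R),
        D.IsDualFamily φ' v' := by
  have hφ : ∀ (i : Fin n) (c : Fin n → R), φ i (∑ j, c j • v j) = c i := by
    intro i c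
    rw [map_sum, Finset.sum_eq_single i]
    · rw [map_smul, hv.2, if_pos rfl, smul_eq_mul, mul_one]
    · intro j _ hj
      rw [map_smul, hv.2, if_neg hj.symm, smul_zero]
    · simp
  by_cases h : ∀ x, x - ∑ i, φ i x • v i ∈ (D.splittingIdeal e).frobeniusPushforward p e
  · left
    refine le_antisymm ?_ (by simpa using hv.card_le)
    have hker : LinearMap.ker (LinearMap.pi fun i => Algebra.linearMap R (ResidueField R) ∘ₗ φ i) ≤
        (D.splittingIdeal e).frobeniusPushforward p e := by
      intro x hx ψ hψ
      have h1 : ψ (x - ∑ i, φ i x • v i) ∈ maximalIdeal R := h x ψ hψ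
      have h2 : ψ (∑ i, φ i x • v i) ∈ maximalIdeal R := by
        rw [map_sum]
        refine sum_mem fun i _ => ?_
        rw [map_smul]
        exact Ideal.mul_mem_right _ _ ((residue_eq_zero_iff _).mp (congrFun hx i))
      have := add_mem h1 h2
      rwa [← map_add, sub_add_cancel] at this
    calc (D.splittingIdeal e).frobeniusColength p e
        ≤ Module.length R (Fin n → ResidueField R) :=
          Module.length_le_of_injective (Submodule.liftQ _ _ (splittingIdeal_le_ker hv.1))
            (LinearMap.ker_eq_bot.mp (Submodule.ker_liftQ_eq_bot _ _ _ hker))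
      _ = n := by rw [length_pi_residueField, Fintype.card_fin]
  · right
    push Not at h
    obtain ⟨x, hx⟩ := h
    rw [Ideal.mem_frobeniusPushforward, mem_splittingIdeal] at hx
    push Not at hx
    obtain ⟨ψ, hψ, hu⟩ := hx
    rw [AddEquiv.apply_symm_apply] at hu
    set y := x - ∑ i, φ i x • v i with hy
    have hφy : ∀ i, φ i y = 0 := fun i => by rw [hy, map_sub, hφ, sub_self]
    obtain ⟨w, hw⟩ := (notMem_maximalIdeal.mp hu).exists_left_inv
    -- Subtracting `∑ ψ (v i) • φ i` makes the new map vanish on the old `v j`. Its value at `y` is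
    -- still `ψ y`, because every `φ i` kills `y`, and `w` normalizes this unit to `1`.
    refine ⟨Fin.cons (w • (ψ - ∑ i, ψ (v i) • φ i)) φ, Fin.cons y v, fun i => ?_, fun i j => ?_⟩
    · cases i using Fin.cases with
      | zero =>
        refine D.smul_mem_component (sub_mem hψ (sum_mem fun i _ => ?_)) _
        exact D.smul_mem_component (hv.1 i) _
      | succ i => exact hv.1 i
    · cases i using Fin.cases with
      | zero =>
        cases j using Fin.cases with
        | zero => simp [LinearMap.sum_apply, hφy, hw]
        | succ j =>
          simp [LinearMap.sum_apply, hv.2, (Fin.succ_ne_zero j).symm]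
      | succ i =>
        cases j using Fin.cases with
        | zero => simp [hφy]
        | succ j => simp [hv.2]

/-- Enlarging a dual family must stop, since its size is bounded by the finite length. -/
theorem exists_isDualFamily {e : ℕ} (h : (D.splittingIdeal e).frobeniusColength p e ≠ ⊤) :
    ∃ (n : ℕ) (φ : Fin n → CartierMap p e R) (v : Fin n → FrobeniusPushforward p e R),
      D.IsDualFamily φ v ∧ (D.splittingIdeal e).frobeniusColength p e = n := by
  by_contra! hc
  obtain ⟨l, hl⟩ := ENat.ne_top_iff_exists.mp h
  have : ∀ n : ℕ, ∃ (φ : Fin n → CartierMap p e R) (v : Fin n → FrobeniusPushforward p e R),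
      D.IsDualFamily φ v := by
    intro n
    induction n with
    | zero => exact ⟨finZeroElim, finZeroElim, finZeroElim, finZeroElim⟩
    | succ n ih =>
      obtain ⟨φ, v, hv⟩ := ih
      exact hv.frobeniusColength_eq_or_exists.resolve_left (hc n φ v hv)
  obtain ⟨φ, v, hv⟩ := this (l + 1)
  have := hv.card_le
  rw [← hl, Fintype.card_fin] at this
  exact absurd (Nat.cast_le.mp this) (by simp)

/-- The `e`-th splitting number is the length of `F^e_* (R / I_e)`, and it is attained by a
family with a dual family in `D_e`. -/
theorem splittingNumber_spec {e : ℕ} (h : (D.splittingIdeal e).frobeniusColength p e ≠ ⊤) :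
    (D.splittingIdeal e).frobeniusColength p e = D.splittingNumber e ∧
      ∃ (φ : Fin (D.splittingNumber e) → CartierMap p e R)
        (v : Fin (D.splittingNumber e) → FrobeniusPushforward p e R), D.IsDualFamily φ v := by
  obtain ⟨n, φ, v, hv, hn⟩ := exists_isDualFamily h
  -- The bound is needed for the supremum to be a genuine maximum: `sSup` of an unbounded set of
  -- naturals is `0`.
  have hub : ∀ a ∈ {a : ℕ | ∃ (n : ℕ) (N : Fin n → Submodule R (FrobeniusPushforward p e R))
      (h : DirectSum.IsInternal N), a = {j : Fin n | D.IsSummand h j}.ncard}, a ≤ n := by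
    rintro _ ⟨m, N, hN, rfl⟩
    classical
    obtain ⟨φ', v', hv'⟩ := exists_isDualFamily_of_isInternal (D := D) hN
    have := hv'.card_le
    rw [hn, Nat.cast_le] at this
    rwa [← Nat.card_coe_set_eq, Nat.card_eq_fintype_card]
  obtain ⟨N, hN, hle⟩ := hv.exists_isInternal
  have : D.splittingNumber e = n := by
    refine le_antisymm (csSup_le ⟨_, n + 1, N, hN, rfl⟩ hub) (hle.trans ?_)
    exact le_csSup ⟨n, hub⟩ ⟨n + 1, N, hN, rfl⟩
  rw [this]
  exact ⟨hn, φ, v, hv⟩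

end LocalRing

section FFinite

variable {p : ℕ} [Fact p.Prime] {R : Type u} [CommRing R] [IsLocalRing R] [IsNoetherianRing R]
  [CharP R p] {D : CartierSubalgebra p R}

theorem exists_frobeniusColength_splittingIdeal_le (hR : IsFFinite p R) {d : ℕ}
    (hd : ringKrullDim R = d) (D : CartierSubalgebra p R) :
    ∃ C : ℕ, ∀ e : ℕ, (D.splittingIdeal e).frobeniusColength p e ≤
      (C * (p ^ d * (frobenius (ResidueField R) p).degree) ^ e : ℕ) := by
  obtain ⟨C, hC⟩ := Ideal.exists_frobeniusColength_le hR (⊥ : Ideal R) bot_ne_top d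
    ((RingEquiv.quotientBot R).ringKrullDim.trans hd).le
  exact ⟨C, fun e => hC e _ bot_le fun x hx => pow_mem_splittingIdeal e hx⟩

theorem frobeniusColength_splittingIdeal (hR : IsFFinite p R) (D : CartierSubalgebra p R) (e : ℕ) :
    (D.splittingIdeal e).frobeniusColength p e = D.splittingNumber e := by
  obtain ⟨d, hd⟩ : ∃ d : ℕ, ringKrullDim R = d := by
    obtain ⟨d, hd⟩ := ENat.ne_top_iff_exists.mp (Ideal.height_ne_top
      (I := maximalIdeal R) (maximalIdeal.isMaximal R).ne_top)
    exact ⟨d, by rw [← IsLocalRing.maximalIdeal_height_eq_ringKrullDim, ← hd]; rfl⟩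
  obtain ⟨C, hC⟩ := exists_frobeniusColength_splittingIdeal_le hR hd D
  exact (splittingNumber_spec (ne_top_of_le_ne_top (ENat.natCast_ne_top _) (hC e))).1

theorem exists_isDualFamily_splittingNumber (hR : IsFFinite p R) (D : CartierSubalgebra p R)
    (e : ℕ) : ∃ (φ : Fin (D.splittingNumber e) → CartierMap p e R)
        (v : Fin (D.splittingNumber e) → FrobeniusPushforward p e R), D.IsDualFamily φ v :=
  (splittingNumber_spec (by
    rw [frobeniusColength_splittingIdeal hR]
    exact ENat.natCast_ne_top _)).2

theorem exists_splittingNumber_le (hR : IsFFinite p R) {d : ℕ}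
    (hd : ringKrullDim R = d) (D : CartierSubalgebra p R) :
    ∃ C : ℕ, ∀ e : ℕ, D.splittingNumber e ≤
      C * (p ^ d * (frobenius (ResidueField R) p).degree) ^ e := by
  obtain ⟨C, hC⟩ := exists_frobeniusColength_splittingIdeal_le hR hd D
  refine ⟨C, fun e => ?_⟩
  have := hC e
  rwa [frobeniusColength_splittingIdeal hR, Nat.cast_le] at this

theorem mem_semigroup_iff (hR : IsFFinite p R) {e : ℕ} :
    e ∈ D.semigroup ↔ ∃ φ ∈ D.component e, ∃ x, φ x = 1 := by
  constructor
  · intro h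
    obtain ⟨φ, v, hv⟩ := exists_isDualFamily_splittingNumber hR D e
    let i : Fin (D.splittingNumber e) := ⟨0, Nat.pos_of_ne_zero h⟩
    exact ⟨φ i, hv.1 i, v i, by rw [hv.2, if_pos rfl]⟩
  · rintro ⟨φ, hφ, x, hx⟩ h0
    have := (IsDualFamily.card_le (D := D) (ι := Unit) (φ := fun _ => φ) (v := fun _ => x)
      ⟨fun _ => hφ, fun _ _ => by simp [hx]⟩)
    rw [frobeniusColength_splittingIdeal hR, h0] at this
    simp at this

theorem add_mem_semigroup (hR : IsFFinite p R) {e e' : ℕ} (h : e ∈ D.semigroup)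
    (h' : e' ∈ D.semigroup) : e + e' ∈ D.semigroup := by
  rw [mem_semigroup_iff hR] at *
  obtain ⟨φ, hφ, x, hx⟩ := h
  obtain ⟨ψ, hψ, y, hy⟩ := h'
  -- With `φ x = ψ y = 1`, one has `ψ (x^(p^e') y) = x ψ y = x`.
  refine ⟨φ.mul ψ, D.mul_mem hφ hψ, .of p (e + e') (((FrobeniusPushforward.of p e).symm x) ^ p ^ e'
    * (FrobeniusPushforward.of p e').symm y), ?_⟩
  change φ (.of p e (ψ (.of p e' (_ * _)))) = 1
  rw [map_pow_mul, AddEquiv.apply_symm_apply, hy, mul_one, AddEquiv.apply_symm_apply, hx]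

/-- If `φ x = 1` and `y^(p^e) = 0`, then `y = y φ x = φ (y^(p^e) x) = 0`. -/
theorem isReduced_of_mem_semigroup (hR : IsFFinite p R) {e : ℕ} (he : e ≠ 0)
    (h : e ∈ D.semigroup) : IsReduced R := by
  obtain ⟨φ, -, x, hx⟩ := (mem_semigroup_iff hR).mp h
  refine (isReduced_iff_pow_one_lt (p ^ e) (Nat.one_lt_pow he (Fact.out : p.Prime).one_lt)).mpr
    fun y hy => ?_
  have := map_pow_mul φ y ((FrobeniusPushforward.of p e).symm x)
  rwa [hy, zero_mul, map_zero, map_zero, AddEquiv.apply_symm_apply, hx, mul_one, eq_comm] at this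

end FFinite

end CartierSubalgebra

/-! ### Domains: generically surjective maps and comparison of splitting numbers. -/

theorem Submodule.exists_smul_mem_span_of_finrank_le {R M : Type*} [CommRing R] [Nontrivial R]
    [AddCommGroup M] [Module R M] [Module.Finite R M] {n : ℕ} {s : Fin n → M}
    (hs : LinearIndependent R s) (hn : Module.finrank R M ≤ n) (x : M) :
    ∃ a : R, a ≠ 0 ∧ a • x ∈ Submodule.span R (Set.range s) := by
  by_contra! h
  have hcons : LinearIndependent R (Fin.cons x s : Fin (n + 1) → M) := by
    refine hs.finCons' x s fun c y hy hcy => ?_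
    by_contra hc
    refine h c hc ?_
    rw [eq_neg_of_add_eq_zero_left hcy]
    exact neg_mem hy
  have := hcons.fintype_card_le_finrank
  rw [Fintype.card_fin] at this
  omega

namespace CartierSubalgebra

section Domain

variable {p : ℕ} {R : Type u} [CommRing R] [IsDomain R] [ExpChar R p]

theorem precompMul_ne_zero {e : ℕ} {φ : CartierMap p e R} (hφ : φ ≠ 0) {s : R} (hs : s ≠ 0) :
    precompMul φ s ≠ 0 := by
  intro h
  refine hφ (LinearMap.ext fun x => ?_)
  have h1 : φ (.of p e (s ^ p ^ e * (FrobeniusPushforward.of p e).symm x)) = 0 := by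
    rw [← Nat.succ_pred_eq_of_pos (expChar_pow_pos R p e), pow_succ', mul_assoc]
    exact LinearMap.congr_fun h (.of p e (s ^ (p ^ e).pred * (FrobeniusPushforward.of p e).symm x))
  rw [map_pow_mul, mul_eq_zero, or_iff_right hs] at h1
  exact h1

/-- If `0 ≠ φ ∈ D_e`, there is a map `F^e_* R → R^n` with components in `D_e`, where `n` is the
rank of `F^e_* R`, whose cokernel is torsion. -/
theorem exists_generically_surjective (D : CartierSubalgebra p R) {e : ℕ}
    [Module.Finite R (FrobeniusPushforward p e R)] {φ : CartierMap p e R}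
    (hφ : φ ∈ D.component e) (hφ0 : φ ≠ 0) :
    ∃ ψ : Fin (Module.finrank R (FrobeniusPushforward p e R)) → CartierMap p e R,
      (∀ i, ψ i ∈ D.component e) ∧ ∃ z : R, z ≠ 0 ∧
        ∀ c : Fin (Module.finrank R (FrobeniusPushforward p e R)) → R,
          ∃ x, ∀ i, ψ i x = z * c i := by
  obtain ⟨s, hs⟩ := exists_linearIndependent_of_le_finrank
    (le_refl (Module.finrank R (FrobeniusPushforward p e R)))
  let t := fun i => (FrobeniusPushforward.of p e).symm (s i)
  let ψ := fun i => precompMul φ (t i)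
  -- `G` is the Gram matrix of the form `(x, y) ↦ φ (x y)` on a maximal independent family. A kernel
  -- vector would give `y ≠ 0` with `φ (y ·)` zero on the span, hence everywhere because `F^e_* R`
  -- is torsion over that span. The adjugate then shows that `z = det G` works.
  let G : Matrix _ _ R := Matrix.of fun i j => ψ i (s j)
  refine ⟨ψ, fun i => D.precompMul_mem_component hφ _, G.det, fun hdet => ?_, fun c => ?_⟩
  · obtain ⟨v, hv, hvG⟩ := Matrix.exists_vecMul_eq_zero_iff.mpr hdet
    set y := ∑ i, v i • s i with hy
    have hy0 : (FrobeniusPushforward.of p e).symm y ≠ 0 := by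
      rw [Ne, EmbeddingLike.map_eq_zero_iff]
      intro h
      exact hv (funext fun i => Fintype.linearIndependent_iff.mp hs v h i)
    refine precompMul_ne_zero hφ0 hy0 ?_
    have hspan : ∀ w ∈ Submodule.span R (Set.range s),
        precompMul φ ((FrobeniusPushforward.of p e).symm y) w = 0 := by
      intro w hw
      induction hw using Submodule.span_induction with
      | mem w hw =>
        obtain ⟨j, rfl⟩ := hw
        have hj : ∑ i, v i * φ (.of p e (t i * t j)) = 0 := congrFun hvG j
        rw [← hj]
        change φ (.of p e (_ * t j)) = _
        rw [hy, map_sum, Finset.sum_mul, map_sum, map_sum]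
        refine Finset.sum_congr rfl fun i _ => ?_
        rw [← map_pow_mul, ← mul_assoc]
        rfl
      | zero => exact map_zero _
      | add a b _ _ ha hb => rw [map_add, ha, hb, add_zero]
      | smul r a _ ha => rw [map_smul, ha, smul_zero]
    ext x
    obtain ⟨a, ha, hax⟩ := Submodule.exists_smul_mem_span_of_finrank_le hs le_rfl x
    have := hspan _ hax
    rw [map_smul, smul_eq_mul, mul_eq_zero, or_iff_right ha] at this
    exact this
  · refine ⟨∑ j, (G.adjugate.mulVec c) j • s j, fun i => ?_⟩
    have : G.mulVec (G.adjugate.mulVec c) = G.det • c := by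
      rw [Matrix.mulVec_mulVec, Matrix.mul_adjugate, Matrix.smul_mulVec, Matrix.one_mulVec]
    rw [map_sum, ← smul_eq_mul, ← Pi.smul_apply, ← this]
    refine Finset.sum_congr rfl fun j _ => ?_
    rw [map_smul, smul_eq_mul, mul_comm]
    rfl

theorem finrank_frobeniusPushforward (e : ℕ) :
    Module.finrank R (FrobeniusPushforward p e R) = (frobenius R p).degree ^ e :=
  FrobeniusTwist.finrank_eq_degree p e R

theorem IsDualFamily.linearIndependent {D : CartierSubalgebra p R} {e n : ℕ}
    {φ : Fin n → CartierMap p e R} {v : Fin n → FrobeniusPushforward p e R}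
    (hv : D.IsDualFamily φ v) : LinearIndependent R v := by
  refine Fintype.linearIndependent_iff.mpr fun g hg i => ?_
  have := congrArg (φ i) hg
  rw [map_sum, Finset.sum_eq_single i, map_smul, hv.2, if_pos rfl, smul_eq_mul, mul_one,
    map_zero] at this
  · exact this
  · intro j _ hj
    rw [map_smul, hv.2, if_neg hj.symm, smul_zero]
  · simp

end Domain

section LocalRing

variable {p : ℕ} {R : Type u} [CommRing R] [IsLocalRing R] [ExpChar R p]

/-- Applying `F^e_*` to the `ψ i` induces a map `F^(e+e₀)_*(R / I_(e+e₀)) → (F^e_*(R / I_e))^n`. Its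
image contains all multiples of `z`, that is, the kernel of the projection to `(F^e_*(R / (I_e +
z)))^n`. -/
theorem mul_frobeniusColength_splittingIdeal_le (D : CartierSubalgebra p R) {e₀ n : ℕ}
    {ψ : Fin n → CartierMap p e₀ R} (hψ : ∀ i, ψ i ∈ D.component e₀) {z : R}
    (hz : ∀ c : Fin n → R, ∃ x, ∀ i, ψ i x = z * c i) (e : ℕ) :
    n * (D.splittingIdeal e).frobeniusColength p e ≤
      (D.splittingIdeal (e + e₀)).frobeniusColength p (e + e₀) +
        n * (D.splittingIdeal e ⊔ Ideal.span {z}).frobeniusColength p e := by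
  let I := (D.splittingIdeal e).frobeniusPushforward p e
  let I' := (D.splittingIdeal e ⊔ Ideal.span {z}).frobeniusPushforward p e
  have hII' : I ≤ I' := Ideal.frobeniusPushforward_mono p e le_sup_left
  let Ψ (i : Fin n) : FrobeniusPushforward p (e + e₀) R →ₗ[R] FrobeniusPushforward p e R :=
    { toFun := fun x => .of p e (ψ i (.of p e₀ ((FrobeniusPushforward.of p (e + e₀)).symm x)))
      map_add' := fun x y => by simp
      map_smul' := fun r x => by
        obtain ⟨x, rfl⟩ := (FrobeniusPushforward.of p (e + e₀)).surjective x
        rw [FrobeniusPushforward.smul_of, AddEquiv.symm_apply_apply, AddEquiv.symm_apply_apply,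
          pow_add, pow_mul, map_pow_mul, RingHom.id_apply, FrobeniusPushforward.smul_of] }
  let F := LinearMap.pi fun i => I.mkQ ∘ₗ Ψ i
  let Q : (Fin n → FrobeniusPushforward p e R ⧸ I) →ₗ[R] Fin n → FrobeniusPushforward p e R ⧸ I' :=
    LinearMap.pi fun i => Submodule.factor hII' ∘ₗ LinearMap.proj i
  have hQ : Function.Surjective Q := by
    intro w
    choose y hy using fun i => Submodule.factor_surjective hII' (w i)
    exact ⟨y, funext hy⟩
  have hF : (D.splittingIdeal (e + e₀)).frobeniusPushforward p (e + e₀) ≤ LinearMap.ker F := by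
    intro x hx
    rw [LinearMap.mem_ker]
    refine funext fun i => (Submodule.Quotient.mk_eq_zero I).mpr ?_
    exact map_mem_splittingIdeal (hψ i) hx
  have hker : LinearMap.ker Q ≤ LinearMap.range (Submodule.liftQ _ F hF) := by
    intro w hw
    rw [Submodule.range_liftQ]
    choose y hy using fun i => Submodule.Quotient.mk_surjective I (w i)
    have hy' : ∀ i, (FrobeniusPushforward.of p e).symm (y i) ∈
        D.splittingIdeal e ⊔ Ideal.span {z} := by
      intro i
      have := congrFun hw i
      rw [LinearMap.pi_apply, LinearMap.comp_apply, LinearMap.proj_apply, ← hy] at this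
      exact (Submodule.Quotient.mk_eq_zero I').mp this
    have : ∀ i, ∃ c, (FrobeniusPushforward.of p e).symm (y i) - z * c ∈ D.splittingIdeal e := by
      intro i
      obtain ⟨a, ha, b, hb, hab⟩ := Submodule.mem_sup.mp (hy' i)
      obtain ⟨c, rfl⟩ := Ideal.mem_span_singleton'.mp hb
      refine ⟨c, ?_⟩
      rw [← hab, mul_comm z c, add_sub_cancel_right]
      exact ha
    choose c hc using this
    obtain ⟨x, hx⟩ := hz c
    refine ⟨.of p (e + e₀) ((FrobeniusPushforward.of p e₀).symm x), funext fun i => ?_⟩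
    rw [← hy, eq_comm]
    refine (Submodule.Quotient.eq I).mpr ?_
    change (FrobeniusPushforward.of p e).symm (y i) - ψ i x ∈ D.splittingIdeal e
    rw [hx]
    exact hc i
  calc n * (D.splittingIdeal e).frobeniusColength p e
      = Module.length R (Fin n → FrobeniusPushforward p e R ⧸ I) := by
        simp [Module.length_pi_of_fintype, Ideal.frobeniusColength, I]
    _ = Module.length R (LinearMap.ker Q) +
        Module.length R (Fin n → FrobeniusPushforward p e R ⧸ I') :=
        Module.length_eq_add_of_exact _ Q (Submodule.subtype_injective _) hQ
          (LinearMap.exact_subtype_ker_map Q)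
    _ ≤ _ := by
        refine add_le_add ?_ (by simp [Module.length_pi_of_fintype, Ideal.frobeniusColength, I'])
        exact (Module.length_le_of_injective _ (Submodule.inclusion_injective hker)).trans
          (Module.length_le_of_surjective _ (LinearMap.surjective_rangeRestrict _))

end LocalRing

/-! ### Reduced rings that are not domains. -/

section NotDomain

variable {p : ℕ} {R : Type u} [CommRing R] [ExpChar R p]

/-- If `n a = 0`, then `n φ a = φ (n^(p^e) a) = 0`. -/
theorem map_mem_annihilator {e : ℕ} (φ : CartierMap p e R) {I : Ideal R} {a : R}
    (ha : a ∈ I.annihilator) : φ (.of p e a) ∈ I.annihilator := by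
  rw [Submodule.mem_annihilator] at ha ⊢
  intro n hn
  rw [smul_eq_mul, mul_comm, ← map_pow_mul, ← Nat.succ_pred_eq_of_pos (expChar_pow_pos R p e),
    pow_succ, mul_assoc, mul_comm n a, ← smul_eq_mul a n, ha n hn, mul_zero, map_zero, map_zero]

theorem annihilator_le_splittingIdeal [IsLocalRing R] (D : CartierSubalgebra p R) {I : Ideal R}
    (hI : I.annihilator ≠ ⊤) (e : ℕ) : I.annihilator ≤ D.splittingIdeal e :=
  fun _ ha φ _ => le_maximalIdeal hI (map_mem_annihilator φ ha)

/-- If `R` is reduced but not a domain, the splitting ideals share a nonzerodivisor. -/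
theorem exists_mem_splittingIdeal_of_not_isDomain [IsLocalRing R] [IsNoetherianRing R] [IsReduced R]
    (D : CartierSubalgebra p R) (h : ¬ IsDomain R) :
    ∃ z ∈ nonZeroDivisors R, ∀ e, z ∈ D.splittingIdeal e := by
  obtain ⟨x, y, hxy, hx, hy⟩ : ∃ x y : R, x * y = 0 ∧ x ≠ 0 ∧ y ≠ 0 := by
    by_contra! hc
    have : NoZeroDivisors R := ⟨fun {a b} hab => or_iff_not_imp_left.mpr (hc a b hab)⟩
    exact h (NoZeroDivisors.to_isDomain R)
  let J := (Ideal.span {x}).annihilator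
  have hJx : ∀ a ∈ J, a * x = 0 := fun a ha =>
    Submodule.mem_annihilator.mp ha x (Ideal.mem_span_singleton_self x)
  have hyJ : y ∈ J := by
    rw [Submodule.mem_annihilator_span_singleton, smul_eq_mul, mul_comm, hxy]
  have hJ : J ≠ ⊤ := fun hJ => hx (by simpa using hJx 1 (hJ ▸ Submodule.mem_top))
  have hJ' : J.annihilator ≠ ⊤ := fun hJ' => hy (by
    simpa using Submodule.mem_annihilator.mp (hJ' ▸ Submodule.mem_top : (1 : R) ∈ J.annihilator) y hyJ)
  -- An element killing both `J` and `Ann J` lies in `Ann J`, so its square is zero; reducedness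
  -- makes it zero.
  obtain ⟨z, hz, hz'⟩ := Ideal.exists_mem_nonZeroDivisors (J ⊔ J.annihilator) fun w hw => by
    have hw' : w ∈ J.annihilator :=
      Submodule.mem_annihilator.mpr fun a ha => hw a (Ideal.mem_sup_left ha)
    have hsq := hw w (Ideal.mem_sup_right hw')
    rw [← pow_two] at hsq
    exact pow_eq_zero_iff two_ne_zero |>.mp hsq
  exact ⟨z, hz', fun e => sup_le (D.annihilator_le_splittingIdeal hJ e)
    (D.annihilator_le_splittingIdeal hJ' e) hz⟩

end NotDomain

/-! ### Asymptotic inequalities for splitting numbers. -/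

section FFinite

variable {p : ℕ} [Fact p.Prime] {R : Type u} [CommRing R] [IsLocalRing R] [IsNoetherianRing R]
  [CharP R p]

theorem exists_pow_mul_splittingNumber_le_of_not_isDomain (hR : IsFFinite p R) {d : ℕ}
    (hd : ringKrullDim R = d) [IsReduced R] (D : CartierSubalgebra p R) (h : ¬ IsDomain R) :
    ∃ C : ℕ, ∀ e, p ^ e * D.splittingNumber e ≤
      C * (p ^ d * (frobenius (ResidueField R) p).degree) ^ e := by
  obtain ⟨z, hz, hzI⟩ := D.exists_mem_splittingIdeal_of_not_isDomain h
  obtain ⟨C, hC⟩ := Ideal.exists_frobeniusColength_le_of_mem_nonZeroDivisors hR hd hz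
  refine ⟨C, fun e => ?_⟩
  have := hC e _ (hzI e) fun x hx => pow_mem_splittingIdeal e hx
  rw [frobeniusColength_splittingIdeal hR] at this
  exact_mod_cast this

theorem splittingNumber_le_degree_pow [IsDomain R] (hR : IsFFinite p R)
    (D : CartierSubalgebra p R) (e : ℕ) : D.splittingNumber e ≤ (frobenius R p).degree ^ e := by
  obtain ⟨φ, v, hv⟩ := exists_isDualFamily_splittingNumber hR D e
  have := hR.finite_frobeniusPushforward e
  have := hv.linearIndependent.fintype_card_le_finrank
  rwa [Fintype.card_fin, finrank_frobeniusPushforward] at this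

/-- The error is `r^(e₀) length F^e_*(R / (I_e + z))`, where `z` depends only on `e₀`; being a
nonzerodivisor, it makes this `O(δ^e / p^e)`. -/
theorem exists_degree_pow_mul_splittingNumber_le [IsDomain R] (hR : IsFFinite p R) {d : ℕ}
    (hd : ringKrullDim R = d) {D : CartierSubalgebra p R} {e₀ : ℕ} (he₀ : e₀ ∈ D.semigroup) :
    ∃ C : ℕ, ∀ e, p ^ e * ((frobenius R p).degree ^ e₀ * D.splittingNumber e) ≤
      p ^ e * D.splittingNumber (e + e₀) +
        C * (p ^ d * (frobenius (ResidueField R) p).degree) ^ e := by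
  obtain ⟨φ, hφ, x, hx⟩ := (mem_semigroup_iff hR).mp he₀
  have hφ0 : φ ≠ 0 := by
    rintro rfl
    exact zero_ne_one hx
  have := hR.finite_frobeniusPushforward e₀
  obtain ⟨ψ, hψ, z, hz, hsurj⟩ := D.exists_generically_surjective hφ hφ0
  obtain ⟨C, hC⟩ := Ideal.exists_frobeniusColength_le_of_mem_nonZeroDivisors hR hd
    (mem_nonZeroDivisors_of_ne_zero hz)
  refine ⟨(frobenius R p).degree ^ e₀ * C, fun e => ?_⟩
  have h1 := D.mul_frobeniusColength_splittingIdeal_le hψ hsurj e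
  have h2 := hC e (D.splittingIdeal e ⊔ Ideal.span {z})
    (Ideal.mem_sup_right (Ideal.mem_span_singleton_self z))
    fun x hx => Ideal.mem_sup_left (pow_mem_splittingIdeal e hx)
  rw [frobeniusColength_splittingIdeal hR, frobeniusColength_splittingIdeal hR,
    finrank_frobeniusPushforward] at h1
  have hfin : (D.splittingIdeal e ⊔ Ideal.span {z}).frobeniusColength p e ≠ ⊤ :=
    ne_top_of_le_ne_top (ENat.natCast_ne_top _)
      ((Ideal.frobeniusColength_anti p e le_sup_left).trans
        (frobeniusColength_splittingIdeal hR D e).le)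
  obtain ⟨l, hl⟩ := ENat.ne_top_iff_exists.mp hfin
  rw [← hl] at h1 h2
  have h1' : (frobenius R p).degree ^ e₀ * D.splittingNumber e ≤
    D.splittingNumber (e + e₀) + (frobenius R p).degree ^ e₀ * l := by exact_mod_cast h1
  have h2' : p ^ e * l ≤ C * (p ^ d * (frobenius (ResidueField R) p).degree) ^ e := by
    exact_mod_cast h2
  calc _ ≤ p ^ e * (D.splittingNumber (e + e₀) + (frobenius R p).degree ^ e₀ * l) :=
        Nat.mul_le_mul_left _ h1'
    _ = p ^ e * D.splittingNumber (e + e₀) + (frobenius R p).degree ^ e₀ * (p ^ e * l) := by ring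
    _ ≤ p ^ e * D.splittingNumber (e + e₀) + (frobenius R p).degree ^ e₀ *
        (C * (p ^ d * (frobenius (ResidueField R) p).degree) ^ e) := by gcongr
    _ = _ := by ring

end FFinite

end CartierSubalgebra

/-! ### Convergence of almost increasing sequences. -/

/-- A bounded real sequence that is increasing up to an error tending to zero converges. -/
theorem exists_tendsto_of_le_add {u ε : ℕ → ℝ} {a b : ℝ} (ha : ∀ m, a ≤ u m) (hb : ∀ m, u m ≤ b)
    (hε : Tendsto ε atTop (𝓝 0)) {J : ℕ} (h : ∀ m, ∀ j ≥ J, u m ≤ u (m + j) + ε m) :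
    ∃ L, Tendsto u atTop (𝓝 L) := by
  have hbdd : IsBoundedUnder (· ≥ ·) atTop u := isBoundedUnder_of ⟨a, ha⟩
  have hcob : IsCoboundedUnder (· ≥ ·) atTop u :=
    (isBoundedUnder_of ⟨b, hb⟩ : IsBoundedUnder (· ≤ ·) atTop u).isCoboundedUnder_ge
  have hle : ∀ m, u m ≤ liminf u atTop + ε m := by
    intro m
    rw [← sub_le_iff_le_add]
    refine le_liminf_of_le hcob ?_
    filter_upwards [eventually_ge_atTop (m + J)] with k hk
    have := h m (k - m) (by omega)
    rw [show m + (k - m) = k by omega] at this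
    linarith
  refine ⟨liminf u atTop, tendsto_order.mpr ⟨fun c hc => eventually_lt_of_lt_liminf hc hbdd,
    fun c hc => ?_⟩⟩
  filter_upwards [hε.eventually_lt_const (sub_pos.mpr hc)] with m hm
  linarith [hle m]

/-- The constant `C` depends on the step `t`, so only two steps are used, which makes one constant
serve for both. Every large multiple of `n` is a sum of these steps, and the accumulated errors form
a series dominated by a geometric one. -/
theorem exists_tendsto_mul_of_le_add {s : ℕ → ℝ} {Γ : Set ℕ} {n n₀ : ℕ} (hn : n ≠ 0)
    (hΓ : ∀ m ≥ n₀, n ∣ m → m ∈ Γ) {a b q : ℝ} (ha : ∀ m, a ≤ s m) (hb : ∀ m, s m ≤ b)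
    (hq : 2 ≤ q) (h : ∀ t ∈ Γ, ∃ C : ℝ, ∀ e, s e ≤ s (e + t) + C / q ^ e) :
    ∃ L, Tendsto (fun m => s (m * n)) atTop (𝓝 L) := by
  have hq0 : 0 < q := by linarith
  have hn1 : 1 ≤ n := Nat.one_le_iff_ne_zero.mpr hn
  have hmem : ∀ m ≥ n₀, m * n ∈ Γ := fun m hm =>
    hΓ _ (hm.trans (Nat.le_mul_of_pos_right _ hn1)) (dvd_mul_left _ _)
  obtain ⟨C₁, hC₁⟩ := h _ (hmem (n₀ + 1) (by omega))
  obtain ⟨C₂, hC₂⟩ := h _ (hmem (n₀ + 2) (by omega))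
  set G : Set ℕ := {(n₀ + 1) * n, (n₀ + 2) * n} with hG
  set C := max 0 (max C₁ C₂) with hC
  have hC0 : 0 ≤ C := le_max_left _ _
  have hpos : ∀ t ∈ G, 1 ≤ t := by
    rintro t (rfl | rfl)
    · exact hn1.trans (Nat.le_mul_of_pos_left _ (by omega))
    · exact hn1.trans (Nat.le_mul_of_pos_left _ (by omega))
  have hstep : ∀ t ∈ G, ∀ e, s e ≤ s (e + t) + C / q ^ e := by
    rintro t (rfl | rfl) e
    · refine (hC₁ e).trans ?_
      gcongr
      exact (le_max_left _ _).trans (le_max_right _ _)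
    · refine (hC₂ e).trans ?_
      gcongr
      exact (le_max_right _ _).trans (le_max_right _ _)
  -- The factor `2` is the sum of a geometric series of ratio `1/2`: each step `x ≥ 1` has `q^x ≥
  -- 2`, so the remaining error `2C / q^(e+x)` is at most `C / q^e`.
  have hclosure : ∀ t ∈ AddSubmonoid.closure G, ∀ e, s e ≤ s (e + t) + 2 * C / q ^ e := by
    intro t ht
    induction ht using AddSubmonoid.closure_induction_left with
    | zero =>
      intro e
      rw [add_zero]
      have : 0 ≤ 2 * C / q ^ e := by positivity
      linarith
    | add_left x hx y _ ih =>
      intro e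
      have h1 := hstep x hx e
      have h2 := ih (e + x)
      have h3 : 2 * C / q ^ (e + x) ≤ C / q ^ e := by
        rw [div_le_div_iff₀ (by positivity) (by positivity), pow_add]
        have : 2 ≤ q ^ x := hq.trans (le_self_pow₀ (by linarith) (by have := hpos x hx; omega))
        have h4 : 0 ≤ C * q ^ e := by positivity
        nlinarith
      have h4 : 2 * C / q ^ e = C / q ^ e + C / q ^ e := by ring
      rw [← add_assoc, h4]
      linarith
  -- The two steps are consecutive multiples of `n`, so their difference is `n`.
  have hgcd : Nat.setGcd G ∣ n := by
    have h1 := Nat.setGcd_dvd_of_mem (s := G) (Set.mem_insert _ _)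
    have h2 := Nat.setGcd_dvd_of_mem (s := G) (Set.mem_insert_of_mem _ rfl)
    have := Nat.dvd_sub h2 h1
    rwa [← Nat.sub_mul, show n₀ + 2 - (n₀ + 1) = 1 by omega, one_mul] at this
  obtain ⟨J, hJ⟩ := Nat.exists_mem_closure_of_ge G
  refine exists_tendsto_of_le_add (ε := fun m => 2 * C / q ^ (m * n)) (J := J)
    (fun m => ha _) (fun m => hb _) ?_ fun m j hj => ?_
  · have h1 : Tendsto (fun m : ℕ => q ^ (m * n)) atTop atTop :=
      (tendsto_pow_atTop_atTop_of_one_lt (by linarith)).comp (tendsto_id.atTop_mul_const' hn1)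
    exact h1.const_div_atTop _
  · rw [add_mul]
    exact hclosure _ (hJ _ (hj.trans (Nat.le_mul_of_pos_right _ hn1))
      (hgcd.trans (dvd_mul_left _ _))) _

theorem IsFFinite.degree_frobenius_residueField_pos {p : ℕ} [Fact p.Prime] {R : Type*} [CommRing R]
    [IsLocalRing R] [CharP R p] (hR : IsFFinite p R) :
    0 < (frobenius (ResidueField R) p).degree := by
  have : Module.Finite (ResidueField R) (FrobeniusTwist p 1 (ResidueField R)) :=
    (hR.frobenius_finite.frobenius_of_surjective _
      (residue_surjective (R := R))).finite_frobeniusTwist 1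
  have : Nontrivial (FrobeniusTwist p 1 (ResidueField R)) :=
    inferInstanceAs (Nontrivial (ResidueField R))
  rw [← pow_one (frobenius (ResidueField R) p).degree, ← FrobeniusTwist.finrank_eq_degree]
  exact Module.finrank_pos

/-! ### Existence of the limit and the main theorem. -/

namespace CartierSubalgebra

theorem normalizedSplittingNumber_eq {p : ℕ} [Fact p.Prime] {R : Type u} [CommRing R]
    [IsLocalRing R] [CharP R p] (hR : IsFFinite p R) (D : CartierSubalgebra p R) (d e : ℕ) :
    D.normalizedSplittingNumber d e = D.splittingNumber e /
      ((p ^ d * (frobenius (ResidueField R) p).degree : ℕ) : ℝ) ^ e := by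
  have hp : (1 : ℝ) < p := by exact_mod_cast (Fact.out : p.Prime).one_lt
  have hc : (0 : ℝ) < (frobenius (ResidueField R) p).degree := by
    exact_mod_cast hR.degree_frobenius_residueField_pos
  rw [normalizedSplittingNumber, frobeniusAlpha, RingHom.finrank_fieldRange, mul_comm,
    Real.rpow_mul_natCast (by linarith), Real.rpow_add (by linarith),
    Real.rpow_logb (by linarith) hp.ne' hc, Real.rpow_natCast]
  norm_cast

variable {p : ℕ} [Fact p.Prime] {R : Type u} [CommRing R] [IsLocalRing R] [IsNoetherianRing R]
  [CharP R p] {D : CartierSubalgebra p R}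

theorem zero_mem_semigroup (hR : IsFFinite p R) (D : CartierSubalgebra p R) : 0 ∈ D.semigroup :=
  (mem_semigroup_iff hR).mpr
    ⟨mulMap p 1, by rw [D.component_zero]; trivial, .of p 0 1, one_mul 1⟩

theorem exists_mem_semigroup_of_ge (hR : IsFFinite p R) (D : CartierSubalgebra p R) :
    ∃ n₀, ∀ m ≥ n₀, D.semigroupIndex ∣ m → m ∈ D.semigroup := by
  obtain ⟨n₀, h⟩ := Nat.exists_mem_closure_of_ge D.semigroup
  let Γ : AddSubmonoid ℕ :=
    { carrier := D.semigroup
      add_mem' := add_mem_semigroup hR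
      zero_mem' := D.zero_mem_semigroup hR }
  exact ⟨n₀, fun m hm hd => AddSubmonoid.closure_le.mpr (le_refl (Γ : Set ℕ)) (h m hm hd)⟩

theorem exists_tendsto_normalizedSplittingNumber (hR : IsFFinite p R) {d : ℕ}
    (hd : ringKrullDim R = d) (D : CartierSubalgebra p R) (hn : D.semigroupIndex ≠ 0) :
    ∃ L, Tendsto (fun m => D.normalizedSplittingNumber d (m * D.semigroupIndex)) atTop (𝓝 L) := by
  set δ := p ^ d * (frobenius (ResidueField R) p).degree with hδ
  have hδ0 : 0 < δ := Nat.mul_pos (pow_pos (Fact.out : p.Prime).pos _)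
    hR.degree_frobenius_residueField_pos
  have hδ1 : (1 : ℝ) ≤ δ := by exact_mod_cast hδ0
  have hp : (2 : ℝ) ≤ p := by exact_mod_cast (Fact.out : p.Prime).two_le
  have hs : ∀ e, D.normalizedSplittingNumber d e = D.splittingNumber e / (δ : ℝ) ^ e :=
    normalizedSplittingNumber_eq hR D d
  have hs0 : ∀ e, 0 ≤ D.normalizedSplittingNumber d e := fun e => by
    rw [hs]
    positivity
  have hmul : Tendsto (fun m => m * D.semigroupIndex) atTop atTop :=
    tendsto_id.atTop_mul_const' (Nat.pos_of_ne_zero hn)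
  obtain ⟨e₀, he₀, he₀'⟩ := Nat.exists_ne_zero_of_setGcd_ne_zero hn
  have : IsReduced R := isReduced_of_mem_semigroup hR he₀' he₀
  by_cases hdom : IsDomain R
  -- This dichotomy avoids having to compute the rank of `F_* R`: a rank below `δ` gives limit `0`,
  -- and a rank of at least `δ` is all that the monotonicity argument needs.
  · obtain hlt | hle := lt_or_ge (frobenius R p).degree δ
    · refine ⟨0, Tendsto.comp (g := D.normalizedSplittingNumber d) (squeeze_zero hs0 (fun e => ?_)
        (tendsto_pow_atTop_nhds_zero_of_lt_one (r := ((frobenius R p).degree : ℝ) / δ)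
          (by positivity) ?_)) hmul⟩
      · rw [hs, div_pow]
        gcongr
        exact_mod_cast splittingNumber_le_degree_pow hR D e
      · rw [div_lt_one (by positivity)]
        exact_mod_cast hlt
    · obtain ⟨n₀, hn₀⟩ := D.exists_mem_semigroup_of_ge hR
      obtain ⟨C, hC⟩ := exists_splittingNumber_le hR hd D
      refine exists_tendsto_mul_of_le_add hn hn₀ hs0 (b := C) (fun e => ?_) hp fun t ht => ?_
      · rw [hs, div_le_iff₀ (by positivity)]
        exact_mod_cast hC e
      · obtain ⟨C, hC⟩ := exists_degree_pow_mul_splittingNumber_le hR hd ht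
        refine ⟨C, fun e => ?_⟩
        -- The error is weakened by the factor `δ^t ≥ 1` so that dividing by `p^e δ^(e+t)` leaves
        -- exactly `C / p^e`.
        have h1 : p ^ e * (δ ^ t * D.splittingNumber e) ≤
            p ^ e * D.splittingNumber (e + t) + C * δ ^ e * δ ^ t := by
          refine le_trans ?_ ((hC e).trans ?_)
          · gcongr
          · exact Nat.add_le_add_left (Nat.le_mul_of_pos_right _ (pow_pos hδ0 t)) _
        have h2 : (p : ℝ) ^ e * (δ ^ t * D.splittingNumber e) ≤
            p ^ e * D.splittingNumber (e + t) + C * δ ^ e * δ ^ t := by exact_mod_cast h1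
        rw [hs, hs]
        have hp0 : (0 : ℝ) < p ^ e := by positivity
        have hδe : (0 : ℝ) < δ ^ e := by positivity
        have hδt : (0 : ℝ) < δ ^ t := by positivity
        rw [pow_add]
        calc (D.splittingNumber e : ℝ) / δ ^ e
            = ((p : ℝ) ^ e * (δ ^ t * D.splittingNumber e)) / (p ^ e * (δ ^ e * δ ^ t)) := by
              field_simp
          _ ≤ (p ^ e * D.splittingNumber (e + t) + C * δ ^ e * δ ^ t) /
                (p ^ e * (δ ^ e * δ ^ t)) := by gcongr
          _ = _ := by field_simp
  · obtain ⟨C, hC⟩ := exists_pow_mul_splittingNumber_le_of_not_isDomain hR hd D hdom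
    have hlim : Tendsto (fun e : ℕ => (C : ℝ) / p ^ e) atTop (𝓝 0) :=
      (tendsto_pow_atTop_atTop_of_one_lt (by linarith)).const_div_atTop _
    refine ⟨0, Tendsto.comp (g := D.normalizedSplittingNumber d)
      (squeeze_zero hs0 (fun e => ?_) hlim) hmul⟩
    rw [hs, div_le_div_iff₀ (by positivity) (by positivity), mul_comm]
    exact_mod_cast hC e

end CartierSubalgebra

theorem theorem3p9 (p : ℕ) [Fact p.Prime] (R : Type u) [CommRing R] [IsLocalRing R]
    [IsNoetherianRing R] [CharP R p] (hF : IsFFinite p R) (d : ℕ) (hd : ringKrullDim R = d)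
    (D : CartierSubalgebra p R) :
    (D.semigroupIndex ≠ 0 →
      D.semigroup.Infinite ∧
      Tendsto (D.normalizedSplittingNumber d) (atTop ⊓ 𝓟 D.semigroup) (𝓝 (D.fSignature d)) ∧
      Tendsto (fun m : ℕ => D.normalizedSplittingNumber d (m * D.semigroupIndex)) atTop
        (𝓝 (D.fSignature d))) ∧
    (D.semigroupIndex = 0 →
      (∀ e : ℕ, 0 < e → D.splittingNumber e = 0) ∧ D.fSignature d = 0) := by
  refine ⟨fun hn => ?_, fun hn => ⟨fun e he => ?_, if_pos hn⟩⟩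
  · obtain ⟨n₀, hn₀⟩ := D.exists_mem_semigroup_of_ge hF
    have hinf : D.semigroup.Infinite := Set.infinite_of_forall_exists_gt fun a =>
      ⟨(a + 1 + n₀) * D.semigroupIndex,
        hn₀ _ ((Nat.le_add_left _ _).trans (Nat.le_mul_of_pos_right _ (Nat.pos_of_ne_zero hn)))
          (dvd_mul_left _ _),
        (by omega : a < a + 1 + n₀).trans_le (Nat.le_mul_of_pos_right _ (Nat.pos_of_ne_zero hn))⟩
    -- Without this the limit along `Γ` would not be unique, and `limUnder` could not be identified
    -- with `L`.
    have hne : (atTop ⊓ 𝓟 D.semigroup).NeBot :=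
      Nat.cofinite_eq_atTop ▸ hinf.cofinite_inf_principal_neBot
    obtain ⟨L, hL⟩ := D.exists_tendsto_normalizedSplittingNumber hF hd hn
    -- Each `e ∈ Γ` is `m n_D` with `m = e / n_D`, so the limit along `Γ` is pulled back from the
    -- limit over `m`.
    have hdiv : Tendsto (fun e => e / D.semigroupIndex) (atTop ⊓ 𝓟 D.semigroup) atTop :=
      (Nat.tendsto_div_const_atTop hn).mono_left inf_le_left
    have hL' : Tendsto (D.normalizedSplittingNumber d) (atTop ⊓ 𝓟 D.semigroup) (𝓝 L) := by
      refine (hL.comp hdiv).congr' ?_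
      filter_upwards [mem_inf_of_right (mem_principal_self D.semigroup)] with e he
      have : D.semigroupIndex ∣ e := Nat.setGcd_dvd_of_mem he
      rw [Function.comp_apply, Nat.div_mul_cancel this]
    have hs : D.fSignature d = L := by
      rw [CartierSubalgebra.fSignature, if_neg hn]
      exact hL'.limUnder_eq
    rw [hs]
    exact ⟨hinf, hL', hL⟩
  · by_contra h
    exact he.ne' (Nat.setGcd_eq_zero_iff.mp hn (show e ∈ D.semigroup from h))
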